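/- Let $G=(V,E)$ be a finite connected trivalent multigraph (loops and multiple edges allowed, $V\neq\emptyset$) with $b$ bridges and $m$ perfect matchings. A perfect matching is a set of non-loop edges such that every vertex is incident to exactly one of them. Let $\Gamma$ be a plane ribbon graph of $G$: a thickening of $G$ to a surface, made of a disc for each vertex and a (possibly half-twisted) band for each edge, such that gluing discs to its boundary circles gives a sphere. The filtered $2$-color vertex homology $\widehat{VCH}{}_2^*(\Gamma)$ over $\mathbb C$ is defined as follows. Cut every band of $\Gamma$ into two half-bands, one at each end. For a set $\alpha$ of half-bands, let $\Gamma_\alpha$ be the collection of circles obtained from the boundary of $\Gamma$ by making the two boundary strands along each half-band in $\alpha$ cross. Let $A=\mathbb C[x]/(x^2-1)$ and associate to $\Gamma_\alpha$ the space $A^{\otimes k}$, where $k$ is the number of circles of $\Gamma_\alpha$. If $h\notin\alpha$, define a linear map from the space of $\Gamma_\alpha$ to that of $\Gamma_{\alpha\cup\{h\}}$ that is the identity on the factors of circles that do not pass along $h$, and that is on the other factors $$x^i\otimes x^j\mapsto x^{i+j},\qquad x^k\mapsto \sum_{\substack{0\le i,j\le 1\\ i+j\equiv k \ (\mathrm{mod}\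 2)}} x^i\otimes x^j,\qquad x^k\mapsto \sqrt2\,x^{k+1},$$ according to whether two circles merge, one circle splits into two, or one circle becomes one circle. For $\nu\subseteq V$ let $\widehat V_\nu$ be the space of $\Gamma_\alpha$ with $\alpha$ the set of all half-bands at vertices of $\nu$, and let $\widehat C^i=\bigoplus_{|\nu|=i}\widehat V_\nu$. Fix a linear order of $V$ and, at each vertex, an order of the three half-bands. For $v\notin\nu$, let $\widehat V_\nu\to\widehat V_{\nu\cup\{v\}}$ be the composition of the three maps that add the half-bands at $v$ one after the other. The differential $\widehat\delta:\widehat C^i\to\widehat C^{i+1}$ is the sum of these maps with the signs $(-1)^{\#\{w\in\nu\,:\,w<v\}}$. Theorem. For every choice of these orders, $\widehat\delta\circ\widehat\delta=0$, and the cohomology $\widehat{VCH}{}_2^1(\Gamma)$ of $(\widehat C^*,\widehat\delta)$ in degree $1$ satisfies $$\dim_{\mathbb C}\widehat{VCH}{}_2^1(\Gamma)=4mb .$$ In particular, $\widehat{VCH}{}_2^1(\Gamma)=0$ if $G$ has no bridges. -/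

import Mathlib

namespace VertexHomology

open scoped Graph

universe u v w

/-! ### Finite multigraphs (loops and multiple edges allowed) -/

section Multigraph

variable {V : Type u} {E : Type v}

/-- Every vertex is the end of exactly three half-edges (a loop is counted twice). -/
def IsTrivalent (G : Graph V E) : Prop :=
  ∀ x ∈ V(G), (G.incidenceSet x).ncard + (G.loopSet x).ncard = 3

/-- There is a vertex, and any two vertices are joined by a walk. -/
def IsConnectedGraph (G : Graph V E) : Prop :=
  V(G).Nonempty ∧ ∀ x ∈ V(G), ∀ y ∈ V(G), Relation.ReflTransGen G.Adj x y

/-- The ends of `e` are no longer joined by a walk once `e` is deleted. -/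
def IsBridge (G : Graph V E) (e : E) : Prop :=
  ∃ x y, G.IsLink e x y ∧ ¬ Relation.ReflTransGen (G.deleteEdges {e}).Adj x y

/-- A set of non-loop edges such that every vertex is incident to exactly one of them. -/
def IsPerfectMatching (G : Graph V E) (M : Set E) : Prop :=
  M ⊆ E(G) ∧ (∀ e ∈ M, ∀ x, ¬ G.IsLoopAt e x) ∧ ∀ x ∈ V(G), ∃! e, e ∈ M ∧ G.Inc e x

end Multigraph

/-! ### Ribbon graphs -/

/-- A ribbon graph without isolated vertices, given by a signed rotation system: `D` is the set of
half-edges, `rot d` is the half-edge that follows `d` in the counterclockwise order at its vertex,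
`opp d` is the other half of the edge of `d`, and `twist e` says that the band of `e` carries a
half-twist (a negative edge). -/
structure RibbonGraph (V : Type u) (E : Type v) (D : Type w) where
  vert : D → V
  edge : D → E
  rot : Equiv.Perm D
  opp : D → D
  twist : E → Bool
  vert_surjective : Function.Surjective vert
  edge_surjective : Function.Surjective edge
  vert_eq_iff : ∀ d d', vert d = vert d' ↔ rot.SameCycle d d'
  opp_opp : ∀ d, opp (opp d) = d
  opp_ne : ∀ d, opp d ≠ d
  edge_eq_iff : ∀ d d', edge d = edge d' ↔ d' = d ∨ d' = opp d

namespace RibbonGraph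

variable {V : Type u} {E : Type v} {D : Type w}

theorem edge_opp (Γ : RibbonGraph V E D) (d : D) : Γ.edge (Γ.opp d) = Γ.edge d :=
  ((Γ.edge_eq_iff d (Γ.opp d)).2 (Or.inr rfl)).symm

/-- The underlying graph of a ribbon graph. -/
def graph (Γ : RibbonGraph V E D) : Graph V E where
  vertexSet := Set.univ
  IsLink e x y := ∃ d, Γ.edge d = e ∧ Γ.vert d = x ∧ Γ.vert (Γ.opp d) = y
  isLink_symm := by
    intro e _
    constructor
    rintro x y ⟨d, rfl, rfl, rfl⟩
    exact ⟨Γ.opp d, Γ.edge_opp d, rfl, by rw [Γ.opp_opp]⟩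
  eq_or_eq_of_isLink_of_isLink := by
    rintro e x y z w ⟨d, rfl, rfl, rfl⟩ ⟨d', h, rfl, rfl⟩
    rcases (Γ.edge_eq_iff d d').1 h.symm with rfl | rfl
    · exact Or.inl rfl
    · exact Or.inr (by rw [Γ.opp_opp])
  left_mem_of_isLink := by
    intros
    trivial

/-! ### States of the bubbled blowup

The matching edges of the bubbled blowup are the half-edges `d : D`, and a state is the set
`α : Finset D` of those that carry a 1-smoothing (crossed strands); the others carry a 0-smoothing
(parallel strands). The point `(d, true)` (`(d, false)`) is the left (right) strand at the inner end
of the matching edge `d`, seen from its vertex. -/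

open Classical in
/-- Points joined by an arc of the state `α`: an arc of the cycle that replaced the vertex joins
the left of `d` to the right of the next half-edge; following the edge of `d`, one gets from the
left (right) of `d` to the right (left) of `opp d`, with one change of side for every crossing on
the way, namely the half-twist of the edge and the 1-smoothings at `d` and at `opp d`. -/
inductive Arc (Γ : RibbonGraph V E D) (α : Finset D) : D × Bool → D × Bool → Prop
  | corner (d : D) : Arc Γ α (d, true) (Γ.rot d, false)
  | edge (d : D) (s : Bool) : Arc Γ α (d, s)
      (Γ.opp d, !(s ^^ Γ.twist (Γ.edge d) ^^ decide (d ∈ α) ^^ decide (Γ.opp d ∈ α)))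

/-- The circles of the state `α`. -/
def StateCircle (Γ : RibbonGraph V E D) (α : Finset D) : Type w :=
  Quot (Γ.Arc α)

/-- The circle of the state `α` through a point. -/
def circ (Γ : RibbonGraph V E D) (α : Finset D) (p : D × Bool) : Γ.StateCircle α :=
  Quot.mk _ p

instance (Γ : RibbonGraph V E D) (α : Finset D) [Finite D] : Finite (Γ.StateCircle α) :=
  inferInstanceAs (Finite (Quot (Γ.Arc α)))

/-- The faces of a ribbon graph: the boundary circles of its bands and discs, that is, the circles
of the all-zero state. -/
abbrev Face (Γ : RibbonGraph V E D) : Type w := Γ.StateCircle ∅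

/-- A ribbon graph with connected underlying graph is plane if the closed surface obtained by
gluing discs to its boundary is a sphere, that is, has Euler characteristic two. -/
def IsPlane (Γ : RibbonGraph V E D) : Prop :=
  (Nat.card V : ℤ) - Nat.card E + Nat.card Γ.Face = 2

/-! ### The vector spaces of the states -/

/-- The monomial basis of `A ^ ⊗ k`, where `A = ℂ[x] / (x ^ n - 1)` and `k` is the number of circles
of `α`: the exponent of `x`, which matters modulo `n` only, on every circle. -/
abbrev Monomial (Γ : RibbonGraph V E D) (n : ℕ) (α : Finset D) : Type w :=
  Γ.StateCircle α → ZMod n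

noncomputable instance (Γ : RibbonGraph V E D) (n : ℕ) [NeZero n] (α : Finset D) [Finite D] :
    Fintype (Γ.Monomial n α) :=
  Fintype.ofFinite _

/-- The vector space `A ^ ⊗ k` of the state `α`, in coordinates with respect to the monomials. -/
abbrev StateSpace (Γ : RibbonGraph V E D) (n : ℕ) (α : Finset D) : Type w :=
  Γ.Monomial n α → ℂ

open Classical in
/-- The coefficient of the monomial `g` in the image of the monomial `f` under the filtered map of
the edge of the hypercube of states that leads from `α` to `α'` by changing the 0-smoothing at `d`
into a 1-smoothing. It is the identity on the circles that do not meet `d`. With `m = ⌊n / 2⌋`, it is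
* the multiplication `x ^ i ⊗ x ^ j ↦ x ^ (i + j)` if two circles merge at `d`,
* `x ^ k ↦ ∑ x ^ i ⊗ x ^ j`, over all exponents `0 ≤ i, j < n` such that `i + j` is `k + 2 m` or
  `k + 2 m - n` (equivalently, `i + j ≡ k + 2 m` modulo `n`), if a circle splits into two at `d`,
* `x ^ k ↦ √n x ^ (k + m)` if one circle becomes one circle. -/
noncomputable def edgeCoeff (Γ : RibbonGraph V E D) (n : ℕ) (α α' : Finset D) (d : D)
    (g : Γ.Monomial n α') (f : Γ.Monomial n α) : ℂ :=
  if ∀ p, Γ.circ α p ≠ Γ.circ α (d, true) → Γ.circ α p ≠ Γ.circ α (d, false) →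
      g (Γ.circ α' p) = f (Γ.circ α p) then
    if Γ.circ α (d, true) ≠ Γ.circ α (d, false) then
      if g (Γ.circ α' (d, true)) = f (Γ.circ α (d, true)) + f (Γ.circ α (d, false))
      then 1 else 0
    else if Γ.circ α' (d, true) ≠ Γ.circ α' (d, false) then
      if g (Γ.circ α' (d, true)) + g (Γ.circ α' (d, false)) =
        f (Γ.circ α (d, true)) + ((2 * (n / 2) : ℕ) : ZMod n)
      then 1 else 0
    else
      if g (Γ.circ α' (d, true)) = f (Γ.circ α (d, true)) + ((n / 2 : ℕ) : ZMod n)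
      then (Real.sqrt n : ℂ) else 0
  else 0

/-- The filtered map of an edge of the hypercube of states of the bubbled blowup. -/
noncomputable def edgeMap (Γ : RibbonGraph V E D) (n : ℕ) [NeZero n] [Finite D]
    (α α' : Finset D) (d : D) : Γ.StateSpace n α →ₗ[ℂ] Γ.StateSpace n α' :=
  Matrix.mulVecLin (Matrix.of (Γ.edgeCoeff n α α' d))

/-! ### The hypercube of vertex states -/

open Classical in
/-- The vertex state with 1-smoothings exactly at the vertices in `S`, as a state of the bubbled
blowup. -/
noncomputable def vertexState (Γ : RibbonGraph V E D) [Fintype D] (S : Finset V) : Finset D :=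
  Finset.univ.filter fun d => Γ.vert d ∈ S

open Classical in
/-- The map of the edge from `S` to `S' = S ∪ {x}` of the hypercube of vertex states: the
composition of the three maps along the path that changes the smoothings at the three half-edges
`h 0`, `h 1`, `h 2` of `x` one after the other. -/
noncomputable def vertexMap (Γ : RibbonGraph V E D) (n : ℕ) [NeZero n] [Fintype D]
    (S S' : Finset V) (h : Fin 3 → D) :
    Γ.StateSpace n (Γ.vertexState S) →ₗ[ℂ] Γ.StateSpace n (Γ.vertexState S') :=
  Γ.edgeMap n (insert (h 1) (insert (h 0) (Γ.vertexState S))) (Γ.vertexState S') (h 2) ∘ₗ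
    Γ.edgeMap n (insert (h 0) (Γ.vertexState S))
      (insert (h 1) (insert (h 0) (Γ.vertexState S))) (h 1) ∘ₗ
    Γ.edgeMap n (Γ.vertexState S) (insert (h 0) (Γ.vertexState S)) (h 0)

/-- The direct sum of the chain groups in all degrees. -/
abbrev Chain (Γ : RibbonGraph V E D) (n : ℕ) [Fintype D] : Type (max u w) :=
  ∀ S : Finset V, Γ.StateSpace n (Γ.vertexState S)

/-- The chain group in degree `i`: the chains supported on the states with `i` 1-smoothings. -/
def chainDegree (Γ : RibbonGraph V E D) (n : ℕ) [Fintype D] (i : ℕ) :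
    Submodule ℂ (Γ.Chain n) where
  carrier := {c | ∀ S : Finset V, S.card ≠ i → c S = 0}
  add_mem' := by
    intro a b ha hb S hS
    simp [ha S hS, hb S hS]
  zero_mem' := fun _ _ => rfl
  smul_mem' := by
    intro r a ha S hS
    simp [ha S hS]

/-- The filtered differential. The sign of the edge that changes the smoothing at `x` is
`(-1) ^ k`, where `k` is the number of the 1-smoothings at vertices before `x`. -/
noncomputable def filteredDifferential [LinearOrder V] (Γ : RibbonGraph V E D) (n : ℕ) [NeZero n]
    [Fintype D] (path : ∀ x : V, Fin 3 ≃ {d : D // Γ.vert d = x}) :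
    Γ.Chain n →ₗ[ℂ] Γ.Chain n :=
  LinearMap.pi fun T => ∑ x ∈ T, ((-1 : ℂ) ^ (T.filter (· < x)).card) •
    (Γ.vertexMap n (T.erase x) T (fun k => (path x k : D)) ∘ₗ LinearMap.proj (T.erase x))

/-- The cocycles in degree `i`. -/
noncomputable def cocycles [LinearOrder V] (Γ : RibbonGraph V E D) (n : ℕ) [NeZero n]
    [Fintype D] (path : ∀ x : V, Fin 3 ≃ {d : D // Γ.vert d = x}) (i : ℕ) :
    Submodule ℂ (Γ.Chain n) :=
  Γ.chainDegree n i ⊓ LinearMap.ker (Γ.filteredDifferential n path)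

/-- The coboundaries in degree `i`: the images of the chains in degree `i - 1`, none if `i = 0`. -/
noncomputable def coboundaries [LinearOrder V] (Γ : RibbonGraph V E D) (n : ℕ) [NeZero n]
    [Fintype D] (path : ∀ x : V, Fin 3 ≃ {d : D // Γ.vert d = x}) :
    ℕ → Submodule ℂ (Γ.Chain n)
  | 0 => ⊥
  | i + 1 => (Γ.chainDegree n i).map (Γ.filteredDifferential n path)

/-- The filtered `n`-color vertex homology in degree `i`. -/
abbrev FilteredVertexHomology [LinearOrder V] (Γ : RibbonGraph V E D) (n : ℕ) [NeZero n]
    [Fintype D] (path : ∀ x : V, Fin 3 ≃ {d : D // Γ.vert d = x}) (i : ℕ) : Type (max u w) :=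
  Γ.cocycles n path i ⧸ (Γ.coboundaries n path i).submoduleOf (Γ.cocycles n path i)

end RibbonGraph

end VertexHomology

/-! Since `x ^ 2 = 1`, evaluation at `x = 1` and `x = -1` identifies `A` with `ℂ × ℂ`, so the space
of a state has a basis indexed by the 2-colourings of its circles. Every point of a circle lies on a
corner of a vertex disc, so all these colourings live on one set: they are the colourings `κ` of the
corners, and `κ` occurs in a state exactly when it is constant on the circles (`Compat`). After
dividing by `√2` times a sign for every circle, the merge, split and one-to-one maps at a half-edge
become one diagonal map (`coord_edgeMap`): it multiplies by `√2` times the sign of the common colour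
of the two strands, and it is zero if the colours differ.

Hence the complex splits over `κ`, and the map of a vertex `x` is invertible on `κ` if the three
corners at `x` have one colour (`MonoAt`) and zero otherwise. Compatibility does not depend on the
smoothing at such a vertex, so a summand that has one is acyclic (only degree one is needed:
`chainCoord_cocycle`, `ker_harmonicPart`). In the other summands the differential vanishes. So the
cohomology in degree one has as basis the pairs `(κ, x)` with `κ` compatible with the state `{x}`
and without unicoloured vertices.

It remains to count them. The unicoloured edges of `κ` form a perfect matching `M`. Conversely the
complement of `M` is a cycle modulo two, which on a sphere bounds a set of faces; this gives `κ₀`,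
compatible with the empty state (`exists_face_coloring`). Every `κ` with the same matching is `κ₀ +
φ` for a function `φ` of the vertex, and compatibility with `{x}` says that `φ` plus the indicator
of `x` is constant along every edge except the matching edge at `x`, across which it changes
(`compat_add_iff`). Such a function exists exactly if that edge is a bridge, and it is then unique
up to a constant. Bridges lie in every perfect matching, so the choices are a matching, a half of a
bridge and a colour: `m * 2b * 2`. -/

namespace VertexHomology.RibbonGraph

open Classical Finset

variable {V E D X : Type*}

/-! ### Changing the smoothing at one half-edge -/

/-- The functions on the points that are constant on the circles of the state `α`. -/
def Respects (Γ : RibbonGraph V E D) (α : Finset D) (F : D × Bool → X) : Prop :=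
  ∀ p q, Γ.Arc α p q → F p = F q

/-- The other end of the edge arc of the state `α` at a point. -/
noncomputable def partner (Γ : RibbonGraph V E D) (α : Finset D) (p : D × Bool) : D × Bool :=
  (Γ.opp p.1, !(p.2 ^^ Γ.twist (Γ.edge p.1) ^^ decide (p.1 ∈ α) ^^ decide (Γ.opp p.1 ∈ α)))

/-- The other end of the corner arc at a point. -/
def cornerPartner (Γ : RibbonGraph V E D) (p : D × Bool) : D × Bool :=
  if p.2 then (Γ.rot p.1, false) else (Γ.rot.symm p.1, true)

theorem partner_partner (Γ : RibbonGraph V E D) (α : Finset D) (p : D × Bool) :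
    Γ.partner α (Γ.partner α p) = p := by
  obtain ⟨d, s⟩ := p
  simp only [partner, Γ.opp_opp, Γ.edge_opp]
  by_cases hb : d ∈ α <;> by_cases hc : Γ.opp d ∈ α <;> simp [hb, hc]

theorem cornerPartner_cornerPartner (Γ : RibbonGraph V E D) (p : D × Bool) :
    Γ.cornerPartner (Γ.cornerPartner p) = p := by
  obtain ⟨d, s⟩ := p
  cases s <;> simp [cornerPartner]

theorem cornerPartner_ne (Γ : RibbonGraph V E D) (p : D × Bool) : Γ.cornerPartner p ≠ p := by
  obtain ⟨d, s⟩ := p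
  cases s <;> simp [cornerPartner]

theorem circ_partner (Γ : RibbonGraph V E D) (α : Finset D) (p : D × Bool) :
    Γ.circ α (Γ.partner α p) = Γ.circ α p :=
  (Quot.sound (Arc.edge p.1 p.2)).symm

theorem circ_corner (Γ : RibbonGraph V E D) (α : Finset D) (d : D) :
    Γ.circ α (d, true) = Γ.circ α (Γ.rot d, false) :=
  Quot.sound (Arc.corner d)

theorem circ_cornerPartner (Γ : RibbonGraph V E D) (α : Finset D) (p : D × Bool) :
    Γ.circ α (Γ.cornerPartner p) = Γ.circ α p := by
  obtain ⟨d, s⟩ := p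
  cases s
  · simpa [cornerPartner] using Γ.circ_corner α (Γ.rot.symm d)
  · simpa [cornerPartner] using (Γ.circ_corner α d).symm

theorem respects_iff {Γ : RibbonGraph V E D} {α : Finset D} {F : D × Bool → X} :
    Γ.Respects α F ↔
      (∀ d, F (d, true) = F (Γ.rot d, false)) ∧ ∀ p, F p = F (Γ.partner α p) := by
  constructor
  · exact fun h => ⟨fun d => h _ _ (Arc.corner d), fun p => h _ _ (Arc.edge p.1 p.2)⟩
  · rintro ⟨h1, h2⟩ p q (d | ⟨d, s⟩)
    · exact h1 d
    · exact h2 (d, s)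

theorem Respects.eq_of_circ_eq {Γ : RibbonGraph V E D} {α : Finset D} {F : D × Bool → X}
    (hF : Γ.Respects α F) {p q : D × Bool} (h : Γ.circ α p = Γ.circ α q) : F p = F q :=
  congrArg (Quot.lift F hF) h

theorem circ_out (Γ : RibbonGraph V E D) (α : Finset D) (c : Γ.StateCircle α) :
    Γ.circ α (Quot.out c) = c :=
  Quot.out_eq c

theorem circ_surjective (Γ : RibbonGraph V E D) (α : Finset D) :
    Function.Surjective (Γ.circ α) :=
  Quot.mk_surjective

/-- Two states that agree except possibly at `d`. -/
def AgreeOff (d : D) (α α' : Finset D) : Prop :=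
  ∀ x, x ≠ d → (x ∈ α ↔ x ∈ α')

theorem AgreeOff.symm {d : D} {α α' : Finset D} (h : AgreeOff d α α') : AgreeOff d α' α :=
  fun x hx => (h x hx).symm

theorem partner_eq_of_agreeOff (Γ : RibbonGraph V E D) {d : D} {α α' : Finset D}
    (h : AgreeOff d α α') {p : D × Bool} (h1 : p.1 ≠ d) (h2 : Γ.opp p.1 ≠ d) :
    Γ.partner α p = Γ.partner α' p := by
  simp only [partner, h _ h1, h _ h2]

/-- Agreement on the two strands at `d` forces one value on all four ends of the two edge arcs
there, so reconnecting these ends is invisible to `F`. -/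
theorem Respects.of_agreeOff {Γ : RibbonGraph V E D} {d : D} {α α' : Finset D}
    (h : AgreeOff d α α') {F : D × Bool → X} (hF : Γ.Respects α F)
    (hd : F (d, true) = F (d, false)) : Γ.Respects α' F := by
  rw [respects_iff] at hF ⊢
  refine ⟨hF.1, ?_⟩
  have key : ∀ s t, F (d, s) = F (Γ.opp d, t) := by
    intro s t
    have h1 : F (d, s) = F (Γ.partner α (Γ.opp d, t)) := by
      have : (Γ.partner α (Γ.opp d, t)).1 = d := by simp [partner, Γ.opp_opp]
      have h2 : Γ.partner α (Γ.opp d, t) = (d, (Γ.partner α (Γ.opp d, t)).2) :=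
        Prod.ext this rfl
      rw [h2]
      cases s <;> cases (Γ.partner α (Γ.opp d, t)).2 <;> simp [hd]
    rw [h1, ← hF.2]
  rintro ⟨x, s⟩
  by_cases h1 : x = d
  · subst h1
    exact key _ _
  by_cases h2 : Γ.opp x = d
  · have h3 : x = Γ.opp d := by rw [← h2, Γ.opp_opp]
    subst h3
    simp only [partner, Γ.opp_opp]
    exact (key _ _).symm
  · rw [← Γ.partner_eq_of_agreeOff h h1 h2, ← hF.2]

/-- The point `p` is on a circle of `α` that passes along `d`. -/
def Through (Γ : RibbonGraph V E D) (α : Finset D) (d : D) (p : D × Bool) : Prop :=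
  Γ.circ α p = Γ.circ α (d, true) ∨ Γ.circ α p = Γ.circ α (d, false)

theorem through_self (Γ : RibbonGraph V E D) (α : Finset D) (d : D) (s : Bool) :
    Γ.Through α d (d, s) := by
  cases s
  · exact Or.inr rfl
  · exact Or.inl rfl

theorem respects_through (Γ : RibbonGraph V E D) (α : Finset D) (d : D) :
    Γ.Respects α (Γ.Through α d) := by
  intro p q h
  have : Γ.circ α p = Γ.circ α q := Quot.sound h
  simp only [Through, this]

/-- The predicate `Through α d` is constant on the circles of `α` and holds on both strands at `d`,
so it is also constant on the circles of `α'`. -/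
theorem Through.of_agreeOff {Γ : RibbonGraph V E D} {d : D} {α α' : Finset D}
    (h : AgreeOff d α α') {p : D × Bool} (hp : Γ.Through α' d p) : Γ.Through α d p := by
  have hR : Γ.Respects α' (Γ.Through α d) := (Γ.respects_through α d).of_agreeOff h
    (propext ⟨fun _ => Γ.through_self _ _ _, fun _ => Γ.through_self _ _ _⟩)
  rcases hp with hp | hp
  · exact (hR.eq_of_circ_eq hp).mpr (Γ.through_self _ _ _)
  · exact (hR.eq_of_circ_eq hp).mpr (Γ.through_self _ _ _)

theorem through_iff_of_agreeOff {Γ : RibbonGraph V E D} {d : D} {α α' : Finset D}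
    (h : AgreeOff d α α') {p : D × Bool} : Γ.Through α d p ↔ Γ.Through α' d p :=
  ⟨Through.of_agreeOff h.symm, Through.of_agreeOff h⟩

theorem circ_eq_of_not_through {Γ : RibbonGraph V E D} {d : D} {α α' : Finset D}
    (h : AgreeOff d α α') {p q : D × Bool} (hp : ¬ Γ.Through α d p)
    (hpq : Γ.circ α p = Γ.circ α q) : Γ.circ α' p = Γ.circ α' q := by
  -- All circles along `d` are collapsed to `none`, so that `F` agrees on the two strands at `d` and
  -- passes to the other state, while the remaining circles stay distinguished.
  let F : D × Bool → Option (Γ.StateCircle α') :=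
    fun x => if Γ.Through α' d x then none else some (Γ.circ α' x)
  have hF' : Γ.Respects α' F := by
    intro x y hxy
    have h1 : Γ.circ α' x = Γ.circ α' y := Quot.sound hxy
    by_cases hx : Γ.Through α' d x
    · simp [F, hx, (Γ.respects_through α' d x y hxy).mp hx]
    · have hy : ¬ Γ.Through α' d y := fun hy => hx ((Γ.respects_through α' d x y hxy).mpr hy)
      simp [F, hx, hy, h1]
  have hF : Γ.Respects α F := hF'.of_agreeOff h.symm (by simp [F, through_self])
  have h2 := hF.eq_of_circ_eq hpq
  have hq : ¬ Γ.Through α d q := by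
    unfold Through at hp ⊢
    rwa [← hpq]
  rw [through_iff_of_agreeOff h] at hp hq
  simpa [F, hp, hq] using h2

theorem circ_eq_iff_of_not_through {Γ : RibbonGraph V E D} {d : D} {α α' : Finset D}
    (h : AgreeOff d α α') {p q : D × Bool} (hp : ¬ Γ.Through α d p) :
    Γ.circ α p = Γ.circ α q ↔ Γ.circ α' p = Γ.circ α' q :=
  ⟨circ_eq_of_not_through h hp,
    circ_eq_of_not_through h.symm (by rwa [through_iff_of_agreeOff h.symm])⟩

theorem card_eq_zero_of_involution {ι : Type*} (s : Finset ι) (g : ι → ι)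
    (hg : ∀ a ∈ s, g a ∈ s) (hne : ∀ a ∈ s, g a ≠ a) (hgg : ∀ a, g (g a) = a) :
    (s.card : ZMod 2) = 0 := by
  have h2 : ∀ a ∈ s, (1 : ZMod 2) + 1 = 0 := fun _ _ => by decide
  have := Finset.sum_involution (s := s) (f := fun _ => (1 : ZMod 2)) (fun a _ => g a) h2
    (fun a ha _ => hne a ha) hg (fun a _ => hgg a)
  simpa using this

/-- If the two strands along `d` are on different circles, then these circles merge when the
strands are crossed. -/
theorem circ_eq_of_circ_ne [Finite D] (Γ : RibbonGraph V E D) {d : D} {α α' : Finset D}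
    (h : AgreeOff d α α') (hd : d ∈ α ↔ d ∉ α')
    (hne : Γ.circ α (d, true) ≠ Γ.circ α (d, false)) :
    Γ.circ α' (d, true) = Γ.circ α' (d, false) := by
  by_contra hne'
  have := Fintype.ofFinite D
  have hopp : ∀ s, ∃ t, Γ.partner α (d, s) = (Γ.opp d, t) ∧
      Γ.partner α' (d, s) = (Γ.opp d, !t) := by
    intro s
    refine ⟨_, rfl, ?_⟩
    have h1 := h _ (Γ.opp_ne d)
    simp only [partner, h1]
    by_cases h2 : d ∈ α'
    · simp [hd, h2]
    · simp [hd, h2]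
  -- Leaving `d` in one state and returning in the other changes the strand.
  have hcross : ∀ t, Γ.partner α' (Γ.partner α (d, t)) = (d, !t) := by
    intro s
    obtain ⟨t, h1, h2⟩ := hopp s
    obtain ⟨t', h3, h4⟩ := hopp (!s)
    have h5 : t' = !t := by
      have : t' ≠ t := by
        rintro rfl
        have := (Γ.partner_partner α (d, s)).symm.trans
          ((congrArg _ (h1.trans h3.symm)).trans (Γ.partner_partner α (d, !s)))
        simp at this
      cases t <;> cases t' <;> simp_all
    subst h5
    rw [h1, ← Γ.partner_partner α' (d, !s), h4]
    simp
  -- Parity argument: if the strands at `d` were on different circles in both states, the corner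
  -- arcs would pair up the points of `S`, and the edge arcs of `α` would pair up the points of `S`
  -- other than `(d, true)`.
  let S : Finset (D × Bool) := Finset.univ.filter fun p =>
    Γ.circ α' p = Γ.circ α' (d, true) ∧ Γ.circ α p = Γ.circ α (d, true)
  have hmem : (d, true) ∈ S := by simp [S]
  have h0 : (S.card : ZMod 2) = 0 := by
    refine card_eq_zero_of_involution S Γ.cornerPartner ?_ (fun p _ => Γ.cornerPartner_ne p)
      Γ.cornerPartner_cornerPartner
    intro p hp
    simpa [S, circ_cornerPartner] using hp
  have h1 : ((S.erase (d, true)).card : ZMod 2) = 0 := by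
    refine card_eq_zero_of_involution _ (Γ.partner α) ?_ ?_ (Γ.partner_partner α)
    · intro p hp
      have hp1 : p ≠ (d, true) := Finset.ne_of_mem_erase hp
      have hp2 : Γ.circ α' p = Γ.circ α' (d, true) ∧ Γ.circ α p = Γ.circ α (d, true) := by
        simpa [S] using Finset.mem_of_mem_erase hp
      have hpd : p.1 ≠ d := by
        intro h3
        obtain ⟨x, s⟩ := p
        simp only at h3
        subst h3
        cases s
        · exact hne hp2.2.symm
        · exact hp1 rfl
      have hpo : Γ.opp p.1 ≠ d := by
        intro h3
        have h4 : ∃ s, Γ.partner α p = (d, s) := ⟨_, Prod.ext h3 rfl⟩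
        obtain ⟨s, h4⟩ := h4
        have h5 : p = Γ.partner α (d, s) := by rw [← h4, partner_partner]
        cases s
        · rw [h5, circ_partner] at hp2
          exact hne hp2.2.symm
        · have h6 := hcross true
          rw [← h5] at h6
          have h7 : Γ.circ α' p = Γ.circ α' (d, false) := by
            rw [← Γ.circ_partner α' p, h6]; rfl
          exact hne' (hp2.1.symm.trans h7)
      refine Finset.mem_erase.2 ⟨?_, ?_⟩
      · intro h3
        exact hpo (congrArg Prod.fst h3)
      · have h3 : Γ.circ α' (Γ.partner α p) = Γ.circ α' p := by
          rw [Γ.partner_eq_of_agreeOff h hpd hpo, circ_partner]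
        simp only [S, Finset.mem_filter, Finset.mem_univ, true_and]
        rw [h3, circ_partner]
        exact hp2
    · intro p _ h3
      exact Γ.opp_ne _ (congrArg Prod.fst h3)
  rw [Finset.card_erase_of_mem hmem] at h1
  have h2 : 0 < S.card := Finset.card_pos.2 ⟨_, hmem⟩
  obtain ⟨k, hk⟩ : ∃ k, S.card = k + 1 := ⟨S.card - 1, by omega⟩
  rw [hk] at h0 h1
  simp only [Nat.add_sub_cancel] at h1
  push_cast at h0
  rw [h1] at h0
  exact absurd h0 (by decide)

/-! ### Walsh functions -/

/-- The nontrivial character of `ZMod 2`. -/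
def sgn (a : ZMod 2) : ℂ := (-1) ^ a.val

theorem sgn_zero : sgn 0 = 1 := by simp [sgn]

theorem sgn_one : sgn 1 = -1 := by simp [sgn, ZMod.val_one]

theorem zmod_two_cases (a : ZMod 2) : a = 0 ∨ a = 1 := by
  revert a; decide

theorem zmod_two_add_self (a : ZMod 2) : a + a = 0 := CharTwo.add_self_eq_zero a

theorem zmod_two_add_eq_zero {a b : ZMod 2} : a + b = 0 ↔ a = b := CharTwo.add_eq_zero

theorem sgn_add (a b : ZMod 2) : sgn (a + b) = sgn a * sgn b := by
  rcases zmod_two_cases a with rfl | rfl <;> rcases zmod_two_cases b with rfl | rfl <;>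
    simp [sgn_zero, sgn_one, zmod_two_add_self]

theorem sgn_mul_self (a : ZMod 2) : sgn a * sgn a = 1 := by
  rw [← sgn_add, zmod_two_add_self, sgn_zero]

section Walsh

variable {ι : Type*} [Fintype ι]

/-- The Walsh function of `ε`. -/
def walsh (ε f : ι → ZMod 2) : ℂ := ∏ c, sgn (ε c * f c)

theorem walsh_zero (ε : ι → ZMod 2) : walsh ε 0 = 1 := by simp [walsh, sgn_zero]

theorem walsh_add (ε f g : ι → ZMod 2) : walsh ε (f + g) = walsh ε f * walsh ε g := by
  simp [walsh, mul_add, sgn_add, Finset.prod_mul_distrib]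

theorem walsh_comm (ε f : ι → ZMod 2) : walsh ε f = walsh f ε := by
  simp [walsh, mul_comm]

theorem walsh_single (ε : ι → ZMod 2) (c : ι) (a : ZMod 2) :
    walsh ε (Pi.single c a) = sgn (ε c * a) := by
  unfold walsh
  rw [Finset.prod_eq_single c]
  · simp
  · intro b _ hb
    simp [hb, sgn_zero]
  · simp

/-- A function on which the translations act through a character is a multiple of it. -/
theorem eq_walsh_mul_of_single (ε : ι → ZMod 2) (R : (ι → ZMod 2) → ℂ)
    (hR : ∀ f c a, R (f + Pi.single c a) = sgn (ε c * a) * R f) (f : ι → ZMod 2) :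
    R f = walsh ε f * R 0 := by
  have key : ∀ s : Finset ι, R (∑ c ∈ s, Pi.single c (f c)) =
      (∏ c ∈ s, sgn (ε c * f c)) * R 0 := by
    intro s
    induction s using Finset.induction_on with
    | empty => simp
    | insert c s hc ih =>
      rw [Finset.sum_insert hc, Finset.prod_insert hc, add_comm, hR, ih, mul_assoc]
  have := key Finset.univ
  rwa [Finset.univ_sum_single] at this

/-- The `Fintype` instance is arbitrary because monomials carry `Fintype.ofFinite` instead of the
instance of function types. -/
theorem sum_walsh [inst : Fintype (ι → ZMod 2)] (f : ι → ZMod 2) :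
    ∑ ε, walsh ε f = if f = 0 then (2 : ℂ) ^ Fintype.card ι else 0 := by
  have h1 : ∑ ε : ι → ZMod 2, walsh ε f = ∏ c, ∑ a : ZMod 2, sgn (a * f c) := by
    rw [Fintype.prod_sum]
    unfold walsh
    convert rfl
  have h2 : ∀ b : ZMod 2, ∑ a : ZMod 2, sgn (a * b) = if b = 0 then 2 else 0 := by
    intro b
    have h3 : ∑ a : ZMod 2, sgn (a * b) = sgn (0 * b) + sgn (1 * b) := Fin.sum_univ_two _
    rw [h3]
    rcases zmod_two_cases b with rfl | rfl
    · simp [sgn_zero]; norm_num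
    · simp [sgn_zero, sgn_one]
  rw [h1]
  simp only [h2]
  split_ifs with hf
  · simp [hf]
  · obtain ⟨c, hc⟩ := Function.ne_iff.1 hf
    exact Finset.prod_eq_zero (Finset.mem_univ c) (by simpa using hc)

/-- Fourier inversion on a power of `ZMod 2`; it makes the passage to coordinates both injective and
surjective. -/
theorem walsh_inversion [Fintype (ι → ZMod 2)] (F : (ι → ZMod 2) → ℂ) (g : ι → ZMod 2) :
    ∑ ε, walsh ε g * ∑ f, walsh ε f * F f = 2 ^ Fintype.card ι * F g := by
  simp only [Finset.mul_sum]
  rw [Finset.sum_comm]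
  have h1 : ∀ f, ∑ ε, walsh ε g * (walsh ε f * F f) =
      if f = g then 2 ^ Fintype.card ι * F g else 0 := by
    intro f
    simp only [← mul_assoc, ← walsh_add]
    rw [← Finset.sum_mul, sum_walsh]
    have h0 : g + f = 0 ↔ f = g := by
      simp only [funext_iff, Pi.add_apply, Pi.zero_apply, zmod_two_add_eq_zero]
      exact forall_congr' fun _ => eq_comm
    simp only [h0]
    split_ifs with h
    · rw [h]
    · rw [zero_mul]
  simp [h1]

end Walsh

/-! ### Colourings of the corners -/

/-- The colour of a point in a colouring of the corners, where the corner from `d` to `rot d` has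
the colour `κ d`. -/
def pointColor (Γ : RibbonGraph V E D) (κ : D → ZMod 2) (p : D × Bool) : ZMod 2 :=
  if p.2 then κ p.1 else κ (Γ.rot.symm p.1)

/-- The circles of the state `α` have a well-defined colour. -/
def Compat (Γ : RibbonGraph V E D) (κ : D → ZMod 2) (α : Finset D) : Prop :=
  Γ.Respects α (Γ.pointColor κ)

/-- The difference of the colours on the two sides of a half-edge. -/
def jump (Γ : RibbonGraph V E D) (κ : D → ZMod 2) (d : D) : ZMod 2 :=
  κ d + κ (Γ.rot.symm d)

theorem pointColor_true (Γ : RibbonGraph V E D) (κ : D → ZMod 2) (d : D) :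
    Γ.pointColor κ (d, true) = κ d := rfl

theorem pointColor_false (Γ : RibbonGraph V E D) (κ : D → ZMod 2) (d : D) :
    Γ.pointColor κ (d, false) = κ (Γ.rot.symm d) := rfl

theorem jump_eq_zero_iff (Γ : RibbonGraph V E D) {κ : D → ZMod 2} {d : D} :
    Γ.jump κ d = 0 ↔ Γ.pointColor κ (d, true) = Γ.pointColor κ (d, false) :=
  zmod_two_add_eq_zero

theorem compat_iff_of_agreeOff {Γ : RibbonGraph V E D} {κ : D → ZMod 2} {d : D}
    {α α' : Finset D} (h : AgreeOff d α α') (hd : Γ.jump κ d = 0) :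
    Γ.Compat κ α ↔ Γ.Compat κ α' :=
  ⟨fun h1 => h1.of_agreeOff h (Γ.jump_eq_zero_iff.1 hd),
    fun h1 => h1.of_agreeOff h.symm (Γ.jump_eq_zero_iff.1 hd)⟩

/-- The colour of a circle. -/
noncomputable def circColor (Γ : RibbonGraph V E D) (κ : D → ZMod 2) (α : Finset D)
    (c : Γ.StateCircle α) : ZMod 2 :=
  Γ.pointColor κ (Quot.out c)

theorem circColor_circ {Γ : RibbonGraph V E D} {κ : D → ZMod 2} {α : Finset D}
    (h : Γ.Compat κ α) (p : D × Bool) : Γ.circColor κ α (Γ.circ α p) = Γ.pointColor κ p :=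
  h.eq_of_circ_eq (Γ.circ_out α _)

noncomputable instance [Finite D] (Γ : RibbonGraph V E D) (α : Finset D) :
    Fintype (Γ.StateCircle α) :=
  Fintype.ofFinite _

/-- The scalar by which a half-edge with the colour `a` on both sides acts. -/
noncomputable def scale (a : ZMod 2) : ℂ := (Real.sqrt 2 : ℂ) * sgn a

theorem scale_mul_self (a : ZMod 2) : scale a * scale a = 2 := by
  have h : (Real.sqrt 2 : ℂ) * (Real.sqrt 2 : ℂ) = 2 := by
    rw [← Complex.ofReal_mul, Real.mul_self_sqrt (by norm_num)]
    norm_num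
  unfold scale
  linear_combination sgn a * sgn a * h + 2 * sgn_mul_self a

theorem scale_ne_zero (a : ZMod 2) : scale a ≠ 0 := by
  intro h
  have := scale_mul_self a
  rw [h] at this
  norm_num at this

/-- The product of the scalars of the colours of the circles. -/
noncomputable def weight [Finite D] (Γ : RibbonGraph V E D) (κ : D → ZMod 2) (α : Finset D) : ℂ :=
  ∏ c, scale (Γ.circColor κ α c)

theorem weight_ne_zero [Finite D] (Γ : RibbonGraph V E D) (κ : D → ZMod 2) (α : Finset D) :
    Γ.weight κ α ≠ 0 :=
  Finset.prod_ne_zero_iff.2 fun _ _ => scale_ne_zero _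

/-- The coordinate of a vector of the state `α` with respect to the colouring `κ`. -/
noncomputable def coord [Finite D] (Γ : RibbonGraph V E D) (κ : D → ZMod 2) (α : Finset D) :
    Γ.StateSpace 2 α →ₗ[ℂ] ℂ :=
  if Γ.Compat κ α then
    (Γ.weight κ α)⁻¹ • ∑ f : Γ.Monomial 2 α, walsh (Γ.circColor κ α) f • LinearMap.proj f
  else 0

theorem coord_of_compat [Finite D] {Γ : RibbonGraph V E D} {κ : D → ZMod 2} {α : Finset D}
    (h : Γ.Compat κ α) (F : Γ.StateSpace 2 α) :
    Γ.coord κ α F = (Γ.weight κ α)⁻¹ * ∑ f : Γ.Monomial 2 α, walsh (Γ.circColor κ α) f * F f := by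
  simp [coord, h]

theorem coord_of_not_compat [Finite D] {Γ : RibbonGraph V E D} {κ : D → ZMod 2} {α : Finset D}
    (h : ¬ Γ.Compat κ α) (F : Γ.StateSpace 2 α) : Γ.coord κ α F = 0 := by
  simp [coord, h]

/-- The colouring of the corners that is induced by a colouring of the circles. -/
def cornerColor (Γ : RibbonGraph V E D) (α : Finset D) (ε : Γ.StateCircle α → ZMod 2) (d : D) :
    ZMod 2 :=
  ε (Γ.circ α (d, true))

theorem pointColor_cornerColor (Γ : RibbonGraph V E D) (α : Finset D)
    (ε : Γ.StateCircle α → ZMod 2) (p : D × Bool) :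
    Γ.pointColor (Γ.cornerColor α ε) p = ε (Γ.circ α p) := by
  obtain ⟨d, s⟩ := p
  cases s
  · simp [pointColor, cornerColor, circ_corner]
  · simp [pointColor, cornerColor]

theorem compat_cornerColor (Γ : RibbonGraph V E D) (α : Finset D)
    (ε : Γ.StateCircle α → ZMod 2) : Γ.Compat (Γ.cornerColor α ε) α := by
  intro p q h
  rw [pointColor_cornerColor, pointColor_cornerColor]
  exact congrArg ε (Quot.sound h)

theorem circColor_cornerColor (Γ : RibbonGraph V E D) (α : Finset D)
    (ε : Γ.StateCircle α → ZMod 2) : Γ.circColor (Γ.cornerColor α ε) α = ε := by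
  funext c
  rw [← Γ.circ_out α c, circColor_circ (Γ.compat_cornerColor α ε), pointColor_cornerColor]

theorem cornerColor_circColor {Γ : RibbonGraph V E D} {κ : D → ZMod 2} {α : Finset D}
    (h : Γ.Compat κ α) : Γ.cornerColor α (Γ.circColor κ α) = κ := by
  funext d
  exact circColor_circ h (d, true)

theorem eq_zero_of_coord_eq_zero [Finite D] (Γ : RibbonGraph V E D) (α : Finset D)
    (F : Γ.StateSpace 2 α) (h : ∀ κ, Γ.coord κ α F = 0) : F = 0 := by
  have h1 : ∀ ε : Γ.StateCircle α → ZMod 2, ∑ f : Γ.Monomial 2 α, walsh ε f * F f = 0 := by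
    intro ε
    have h2 := h (Γ.cornerColor α ε)
    rw [coord_of_compat (Γ.compat_cornerColor α ε), circColor_cornerColor] at h2
    exact (mul_eq_zero.1 h2).resolve_left (inv_ne_zero (Γ.weight_ne_zero _ _))
  funext g
  have h2 := walsh_inversion F g
  simp only [h1, mul_zero, Finset.sum_const_zero] at h2
  exact (mul_eq_zero.1 h2.symm).resolve_left (pow_ne_zero _ two_ne_zero)

/-- Compatible corner colourings correspond to circle colourings through `cornerColor` and
`circColor`, so the inverse Walsh transform of the values, rescaled by `weight`, has the required
coordinates. -/
theorem exists_coord_eq [Finite D] (Γ : RibbonGraph V E D) (α : Finset D)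
    (a : (D → ZMod 2) → ℂ) (ha : ∀ κ, ¬ Γ.Compat κ α → a κ = 0) :
    ∃ F : Γ.StateSpace 2 α, ∀ κ, Γ.coord κ α F = a κ := by
  let A : (Γ.StateCircle α → ZMod 2) → ℂ := fun ε =>
    Γ.weight (Γ.cornerColor α ε) α * a (Γ.cornerColor α ε)
  refine ⟨fun f => (2 ^ Fintype.card (Γ.StateCircle α))⁻¹ *
    ∑ ε : Γ.Monomial 2 α, walsh ε f * A ε, fun κ => ?_⟩
  by_cases h : Γ.Compat κ α
  · rw [coord_of_compat h]
    have h1 := walsh_inversion A (Γ.circColor κ α)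
    have h2 : ∑ f : Γ.Monomial 2 α, walsh (Γ.circColor κ α) f *
        ((2 ^ Fintype.card (Γ.StateCircle α))⁻¹ * ∑ ε : Γ.Monomial 2 α, walsh ε f * A ε) =
        A (Γ.circColor κ α) := by
      rw [eq_comm, ← mul_right_inj' (a := (2 : ℂ) ^ Fintype.card (Γ.StateCircle α))
        (pow_ne_zero _ two_ne_zero), ← h1, Finset.mul_sum]
      refine Finset.sum_congr rfl fun f _ => ?_
      rw [walsh_comm f, mul_left_comm, mul_inv_cancel_left₀ (pow_ne_zero _ two_ne_zero)]
      simp only [walsh_comm f]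
    rw [h2]
    simp only [A, cornerColor_circColor h]
    exact inv_mul_cancel_left₀ (Γ.weight_ne_zero _ _) _
  · rw [coord_of_not_compat h, ha κ h]

/-! ### The maps of the edges of the hypercube in coordinates -/

/-- For two colours the shift `2 * (n / 2)` vanishes modulo `n` and `n / 2` is `1`. -/
theorem edgeCoeff_two (Γ : RibbonGraph V E D) (d : D) (α α' : Finset D)
    (g : Γ.Monomial 2 α') (f : Γ.Monomial 2 α) :
    Γ.edgeCoeff 2 α α' d g f =
      if ∀ q, ¬ Γ.Through α d q → g (Γ.circ α' q) = f (Γ.circ α q) then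
        if Γ.circ α (d, true) = Γ.circ α (d, false) then
          if Γ.circ α' (d, true) = Γ.circ α' (d, false) then
            if g (Γ.circ α' (d, true)) = f (Γ.circ α (d, true)) + 1
            then (Real.sqrt 2 : ℂ) else 0
          else if g (Γ.circ α' (d, true)) + g (Γ.circ α' (d, false)) = f (Γ.circ α (d, true))
            then 1 else 0
        else if g (Γ.circ α' (d, true)) = f (Γ.circ α (d, true)) + f (Γ.circ α (d, false))
          then 1 else 0
      else 0 := by
  have h2 : ((2 * (2 / 2) : ℕ) : ZMod 2) = 0 := by decide
  have h3 : ((2 / 2 : ℕ) : ZMod 2) = 1 := by decide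
  unfold edgeCoeff
  rw [h2, h3]
  simp only [add_zero, ite_not, Through, not_or, and_imp, Nat.cast_ofNat, ne_eq]

theorem edgeCoeff_two_zero (Γ : RibbonGraph V E D) {d : D} {α α' : Finset D}
    (h : AgreeOff d α α') (g : Γ.Monomial 2 α') :
    Γ.edgeCoeff 2 α α' d g 0 =
      if ∀ c, c ≠ Γ.circ α' (d, true) → c ≠ Γ.circ α' (d, false) → g c = 0 then
        if Γ.circ α (d, true) = Γ.circ α (d, false) then
          if Γ.circ α' (d, true) = Γ.circ α' (d, false) then
            if g (Γ.circ α' (d, true)) = 1 then (Real.sqrt 2 : ℂ) else 0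
          else if g (Γ.circ α' (d, true)) = g (Γ.circ α' (d, false)) then 1 else 0
        else if g (Γ.circ α' (d, true)) = 0 then 1 else 0
      else 0 := by
  have hoff : (∀ q, ¬ Γ.Through α d q → g (Γ.circ α' q) = (0 : Γ.Monomial 2 α) (Γ.circ α q)) ↔
      ∀ c, c ≠ Γ.circ α' (d, true) → c ≠ Γ.circ α' (d, false) → g c = 0 := by
    rw [(Γ.circ_surjective α').forall]
    refine forall_congr' fun q => ?_
    rw [through_iff_of_agreeOff h, Through, not_or, and_imp]
    rfl
  rw [edgeCoeff_two]
  refine if_congr hoff ?_ rfl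
  simp only [Pi.zero_apply, zero_add, zmod_two_add_eq_zero]

/-- The map of an edge is linear over `A`: multiplication by `x ^ a` on the circle through `p` can
be done before or after it. Such a map is determined by the image of the monomial `1`. -/
theorem edgeCoeff_add_single [Finite D] (Γ : RibbonGraph V E D) {d : D} {α α' : Finset D}
    (h : AgreeOff d α α') (hd : d ∈ α ↔ d ∉ α') (g : Γ.Monomial 2 α') (f : Γ.Monomial 2 α)
    (p : D × Bool) (a : ZMod 2) :
    Γ.edgeCoeff 2 α α' d (g + Pi.single (Γ.circ α' p) a) (f + Pi.single (Γ.circ α p) a) =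
      Γ.edgeCoeff 2 α α' d g f := by
  have hoff : (∀ q, ¬ Γ.Through α d q →
      (g + Pi.single (Γ.circ α' p) a : Γ.Monomial 2 α') (Γ.circ α' q) =
        (f + Pi.single (Γ.circ α p) a : Γ.Monomial 2 α) (Γ.circ α q)) ↔
      ∀ q, ¬ Γ.Through α d q → g (Γ.circ α' q) = f (Γ.circ α q) := by
    refine forall_congr' fun q => forall_congr' fun h1 => ?_
    have h3 := circ_eq_iff_of_not_through (q := p) h h1
    by_cases h4 : Γ.circ α q = Γ.circ α p
    · simp [h4, h3.1 h4]
    · simp [h4, h3.not.1 h4]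
  rw [edgeCoeff_two, edgeCoeff_two]
  refine if_congr hoff ?_ rfl
  by_cases ht : Γ.Through α d p
  · have ht' := (through_iff_of_agreeOff h).1 ht
    by_cases h1 : Γ.circ α (d, true) = Γ.circ α (d, false)
    · have h4 : Γ.circ α (d, true) = Γ.circ α p := by
        rcases ht with ht | ht
        · rw [ht]
        · rw [ht, h1]
      rw [if_pos h1, if_pos h1]
      by_cases h5 : Γ.circ α' (d, true) = Γ.circ α' (d, false)
      · have h6 : Γ.circ α' (d, true) = Γ.circ α' p := by
          rcases ht' with ht | ht
          · rw [ht]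
          · rw [ht, h5]
        rw [if_pos h5, if_pos h5]
        refine if_congr ?_ rfl rfl
        rw [h4, h6, Pi.add_apply, Pi.add_apply, Pi.single_eq_same, Pi.single_eq_same,
          add_right_comm, add_left_inj]
      · rw [if_neg h5, if_neg h5]
        refine if_congr ?_ rfl rfl
        rcases ht' with ht | ht
        · rw [h4, ht, Pi.add_apply, Pi.add_apply, Pi.add_apply, Pi.single_eq_same,
            Pi.single_eq_same, Pi.single_eq_of_ne (Ne.symm h5), add_zero, add_right_comm,
            add_left_inj]
        · rw [h4, ht, Pi.add_apply, Pi.add_apply, Pi.add_apply, Pi.single_eq_same,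
            Pi.single_eq_same, Pi.single_eq_of_ne h5, add_zero, ← add_assoc, add_left_inj]
    · have h5 := Γ.circ_eq_of_circ_ne h hd h1
      have h6 : Γ.circ α' (d, true) = Γ.circ α' p := by
        rcases ht' with ht | ht
        · rw [ht]
        · rw [ht, h5]
      rw [if_neg h1, if_neg h1]
      refine if_congr ?_ rfl rfl
      rcases ht with ht | ht
      · rw [h6, ht, Pi.add_apply, Pi.add_apply, Pi.add_apply, Pi.single_eq_same,
          Pi.single_eq_same, Pi.single_eq_of_ne (Ne.symm h1), add_zero, add_right_comm,
          add_left_inj]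
      · rw [h6, ht, Pi.add_apply, Pi.add_apply, Pi.add_apply, Pi.single_eq_same,
          Pi.single_eq_same, Pi.single_eq_of_ne h1, add_zero, ← add_assoc, add_left_inj]
  · have ht' := (through_iff_of_agreeOff h).not.1 ht
    unfold Through at ht ht'
    push Not at ht ht'
    simp [ht.1.symm, ht.2.symm, ht'.1.symm, ht'.2.symm]

/-- The product of the scalars of the colours of the circles that do not pass along `d`. -/
noncomputable def weightOff [Finite D] (Γ : RibbonGraph V E D) (κ : D → ZMod 2) (α : Finset D)
    (d : D) : ℂ :=
  ∏ c with c ≠ Γ.circ α (d, true) ∧ c ≠ Γ.circ α (d, false), scale (Γ.circColor κ α c)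

theorem weightOff_eq [Finite D] (Γ : RibbonGraph V E D) {κ : D → ZMod 2} {d : D}
    {α α' : Finset D} (h : AgreeOff d α α') (hα : Γ.Compat κ α) (hα' : Γ.Compat κ α') :
    Γ.weightOff κ α d = Γ.weightOff κ α' d := by
  have hmap : ∀ β β' : Finset D, AgreeOff d β β' → ∀ c : Γ.StateCircle β,
      (c ≠ Γ.circ β (d, true) ∧ c ≠ Γ.circ β (d, false)) →
      (Γ.circ β' (Quot.out c) ≠ Γ.circ β' (d, true) ∧
        Γ.circ β' (Quot.out c) ≠ Γ.circ β' (d, false)) ∧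
      Γ.circ β (Quot.out (Γ.circ β' (Quot.out c))) = c := by
    intro β β' hβ c hc
    have h1 : ¬ Γ.Through β d (Quot.out c) := by
      unfold Through
      rw [circ_out]
      exact not_or.2 hc
    have h2 := (through_iff_of_agreeOff hβ).not.1 h1
    refine ⟨not_or.1 h2, ?_⟩
    have h3 := (circ_eq_iff_of_not_through hβ.symm h2).1 (Γ.circ_out β' _).symm
    rw [← h3, circ_out]
  unfold weightOff
  refine Finset.prod_bij' (fun c _ => Γ.circ α' (Quot.out c)) (fun c _ => Γ.circ α (Quot.out c))
    ?_ ?_ ?_ ?_ ?_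
  · intro c hc
    simpa using (hmap α α' h c (by simpa using hc)).1
  · intro c hc
    simpa using (hmap α' α h.symm c (by simpa using hc)).1
  · intro c hc
    exact (hmap α α' h c (by simpa using hc)).2
  · intro c hc
    exact (hmap α' α h.symm c (by simpa using hc)).2
  · intro c _
    rw [circColor_circ hα', ← circColor_circ hα, circ_out]

/-- Two different circles along `d` share their colour here, so their signs cancel and they
contribute `√2 * √2 = 2`. -/
theorem weight_eq [Finite D] (Γ : RibbonGraph V E D) {κ : D → ZMod 2} {d : D} {α : Finset D}
    (hα : Γ.Compat κ α) (hd : Γ.jump κ d = 0) :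
    Γ.weight κ α = Γ.weightOff κ α d *
      if Γ.circ α (d, true) = Γ.circ α (d, false) then scale (κ d) else 2 := by
  unfold weight weightOff
  rw [← Finset.prod_filter_mul_prod_filter_not Finset.univ
    (fun c => c ≠ Γ.circ α (d, true) ∧ c ≠ Γ.circ α (d, false))]
  congr 1
  have h1 : (Finset.univ.filter fun c => ¬ (c ≠ Γ.circ α (d, true) ∧ c ≠ Γ.circ α (d, false))) =
      {Γ.circ α (d, true), Γ.circ α (d, false)} := by
    ext c
    simp only [Finset.mem_filter, Finset.mem_univ, true_and, Finset.mem_insert,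
      Finset.mem_singleton]
    tauto
  rw [h1]
  split_ifs with h2
  · rw [h2, Finset.pair_eq_singleton, Finset.prod_singleton, ← h2, circColor_circ hα,
      pointColor_true]
  · rw [Finset.prod_pair h2, circColor_circ hα, circColor_circ hα, ← Γ.jump_eq_zero_iff.1 hd,
      pointColor_true, scale_mul_self]

/-- The coefficients of the constant monomial `1`, summed against a Walsh function. -/
theorem sum_walsh_mul_edgeCoeff_zero [Finite D] (Γ : RibbonGraph V E D) {κ : D → ZMod 2} {d : D}
    {α α' : Finset D} (h : AgreeOff d α α') (hd : d ∈ α ↔ d ∉ α')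
    (hα : Γ.Compat κ α) (hα' : Γ.Compat κ α') (hj : Γ.jump κ d = 0) :
    (∑ g : Γ.Monomial 2 α', walsh (Γ.circColor κ α') g * Γ.edgeCoeff 2 α α' d g 0) *
      Γ.weight κ α = scale (κ d) * Γ.weight κ α' := by
  have hk : ∀ s, Γ.circColor κ α' (Γ.circ α' (d, s)) = κ d := by
    intro s
    rw [circColor_circ hα']
    cases s
    · rw [← Γ.jump_eq_zero_iff.1 hj]; rfl
    · rfl
  have hz : ∀ c, c ≠ Γ.circ α' (d, true) → c ≠ Γ.circ α' (d, false) →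
      (0 : Γ.Monomial 2 α') c = 0 := fun _ _ _ => rfl
  rw [Γ.weight_eq hα hj, Γ.weight_eq hα' hj, Γ.weightOff_eq h hα hα']
  -- The image of `1` evaluates to `scale (κ d)`, `2` or `1` when a circle stays one, splits, or two
  -- circles merge. The weights along `d` before and after are `scale` and `scale`, `scale` and `2`,
  -- `2` and `scale`, so the normalized ratio is `scale (κ d)` each time.
  by_cases h1 : Γ.circ α (d, true) = Γ.circ α (d, false)
  · by_cases h2 : Γ.circ α' (d, true) = Γ.circ α' (d, false)
    · rw [Finset.sum_eq_single (Pi.single (Γ.circ α' (d, true)) 1)]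
      · have h3 : Γ.edgeCoeff 2 α α' d (Pi.single (Γ.circ α' (d, true)) 1) 0 =
            (Real.sqrt 2 : ℂ) := by
          have h4 : ∀ c, c ≠ Γ.circ α' (d, true) → c ≠ Γ.circ α' (d, false) →
              (Pi.single (Γ.circ α' (d, true)) 1 : Γ.Monomial 2 α') c = 0 :=
            fun c hc _ => Pi.single_eq_of_ne hc _
          rw [Γ.edgeCoeff_two_zero h, if_pos h4, if_pos h1, if_pos h2,
            if_pos (Pi.single_eq_same _ _)]
        rw [h3, walsh_single, hk, if_pos h1, if_pos h2, mul_one]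
        simp only [scale]
        ring
      · intro g _ hg
        rw [mul_eq_zero]
        right
        rw [Γ.edgeCoeff_two_zero h]
        by_cases h3 : ∀ c, c ≠ Γ.circ α' (d, true) → c ≠ Γ.circ α' (d, false) → g c = 0
        · have h4 : g (Γ.circ α' (d, true)) ≠ 1 := by
            intro h5
            apply hg
            funext c
            by_cases h6 : c = Γ.circ α' (d, true)
            · rw [h6, Pi.single_eq_same, h5]
            · rw [Pi.single_eq_of_ne h6, h3 c h6 (by rwa [← h2])]
          rw [if_pos h3, if_pos h1, if_pos h2, if_neg h4]
        · rw [if_neg h3]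
      · simp
    · let g₁ : Γ.Monomial 2 α' :=
        Pi.single (Γ.circ α' (d, true)) 1 + Pi.single (Γ.circ α' (d, false)) 1
      have hg₁t : g₁ (Γ.circ α' (d, true)) = 1 := by simp [g₁, h2]
      have hg₁f : g₁ (Γ.circ α' (d, false)) = 1 := by simp [g₁, Ne.symm h2]
      have hg₁o : ∀ c, c ≠ Γ.circ α' (d, true) → c ≠ Γ.circ α' (d, false) → g₁ c = 0 := by
        intro c hc hc'
        simp [g₁, hc, hc']
      have hne : (0 : Γ.Monomial 2 α') ≠ g₁ := by
        intro h3
        have := congrFun h3 (Γ.circ α' (d, true))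
        rw [hg₁t] at this
        exact zero_ne_one this
      have h3 : Γ.edgeCoeff 2 α α' d 0 0 = 1 := by
        rw [Γ.edgeCoeff_two_zero h]
        rw [if_pos hz]
        simp [h1, h2]
      have h4 : Γ.edgeCoeff 2 α α' d g₁ 0 = 1 := by
        rw [Γ.edgeCoeff_two_zero h]
        rw [if_pos (hg₁o)]
        simp [h1, h2, hg₁t, hg₁f]
      have h5 : walsh (Γ.circColor κ α') g₁ = 1 := by
        simp only [g₁]
        rw [walsh_add, walsh_single, walsh_single, hk, hk, mul_one, sgn_mul_self]
      rw [← Finset.sum_subset (Finset.subset_univ {0, g₁}), Finset.sum_pair hne, h3, h4, h5,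
        walsh_zero, if_pos h1, if_neg h2]
      · ring
      · intro g _ hg
        rw [mul_eq_zero]
        right
        rw [Γ.edgeCoeff_two_zero h]
        by_cases h6 : ∀ c, c ≠ Γ.circ α' (d, true) → c ≠ Γ.circ α' (d, false) → g c = 0
        · have h7 : g (Γ.circ α' (d, true)) ≠ g (Γ.circ α' (d, false)) := by
            intro h8
            apply hg
            rw [Finset.mem_insert, Finset.mem_singleton]
            rcases zmod_two_cases (g (Γ.circ α' (d, true))) with h9 | h9
            · left
              funext c
              by_cases hc : c = Γ.circ α' (d, true)
              · rw [hc, h9]; rfl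
              by_cases hc' : c = Γ.circ α' (d, false)
              · rw [hc', ← h8, h9]; rfl
              · rw [h6 c hc hc']; rfl
            · right
              funext c
              by_cases hc : c = Γ.circ α' (d, true)
              · rw [hc, h9, hg₁t]
              by_cases hc' : c = Γ.circ α' (d, false)
              · rw [hc', ← h8, h9, hg₁f]
              · rw [h6 c hc hc', hg₁o c hc hc']
          rw [if_pos h6, if_pos h1, if_neg h2, if_neg h7]
        · rw [if_neg h6]
  · have h2 := Γ.circ_eq_of_circ_ne h hd h1
    rw [Finset.sum_eq_single 0]
    · have h3 : Γ.edgeCoeff 2 α α' d 0 0 = 1 := by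
        rw [Γ.edgeCoeff_two_zero h]
        rw [if_pos hz]
        simp [h1]
      rw [h3, walsh_zero, if_neg h1, if_pos h2]
      linear_combination (-Γ.weightOff κ α' d) * scale_mul_self (κ d)
    · intro g _ hg
      rw [mul_eq_zero]
      right
      rw [Γ.edgeCoeff_two_zero h]
      by_cases h3 : ∀ c, c ≠ Γ.circ α' (d, true) → c ≠ Γ.circ α' (d, false) → g c = 0
      · have h4 : g (Γ.circ α' (d, true)) ≠ 0 := by
          intro h5
          apply hg
          funext c
          by_cases h6 : c = Γ.circ α' (d, true)
          · rw [h6, h5]; rfl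
          · exact h3 c h6 (by rwa [← h2])
        rw [if_pos h3, if_neg h1, if_neg h4]
      · rw [if_neg h3]
    · simp

/-- In coordinates, the map of an edge of the hypercube of states is diagonal. -/
theorem coord_edgeMap [Finite D] (Γ : RibbonGraph V E D) (κ : D → ZMod 2) {d : D}
    {α α' : Finset D} (h : AgreeOff d α α') (hd : d ∈ α ↔ d ∉ α') (F : Γ.StateSpace 2 α) :
    Γ.coord κ α' (Γ.edgeMap 2 α α' d F) =
      if Γ.jump κ d = 0 then scale (κ d) * Γ.coord κ α F else 0 := by
  by_cases hα' : Γ.Compat κ α'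
  swap
  · rw [coord_of_not_compat hα']
    split_ifs with hj
    · rw [coord_of_not_compat, mul_zero]
      rwa [compat_iff_of_agreeOff h hj]
    · rfl
  -- The row of the map in coordinates. By linearity over `A`, translation by a generator at the
  -- circle through `p` multiplies it by the sign of the colour of `p`.
  let R : Γ.Monomial 2 α → ℂ := fun f =>
    ∑ g : Γ.Monomial 2 α', walsh (Γ.circColor κ α') g * Γ.edgeCoeff 2 α α' d g f
  have hR : ∀ f p a, R (f + Pi.single (Γ.circ α p) a) = sgn (Γ.pointColor κ p * a) * R f := by
    intro f p a
    simp only [R]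
    rw [← Equiv.sum_comp (Equiv.addRight (Pi.single (Γ.circ α' p) a : Γ.Monomial 2 α')),
      Finset.mul_sum]
    refine Finset.sum_congr rfl fun g _ => ?_
    rw [Equiv.coe_addRight, Γ.edgeCoeff_add_single h hd, walsh_add, walsh_single,
      circColor_circ hα']
    ring
  have h1 : Γ.coord κ α' (Γ.edgeMap 2 α α' d F) =
      (Γ.weight κ α')⁻¹ * ∑ f : Γ.Monomial 2 α, R f * F f := by
    rw [coord_of_compat hα']
    congr 1
    simp only [edgeMap, Matrix.mulVecLin_apply, Matrix.mulVec, dotProduct, Matrix.of_apply, R,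
      Finset.mul_sum, Finset.sum_mul]
    rw [Finset.sum_comm]
    simp only [mul_assoc]
  rw [h1]
  split_ifs with hj
  · have hα := (compat_iff_of_agreeOff h hj).2 hα'
    have h2 : ∀ f, R f = walsh (Γ.circColor κ α) f * R 0 := by
      refine eq_walsh_mul_of_single _ R fun f c a => ?_
      rw [← Γ.circ_out α c, hR, circColor_circ hα]
    have h3 : R 0 * Γ.weight κ α = scale (κ d) * Γ.weight κ α' :=
      Γ.sum_walsh_mul_edgeCoeff_zero h hd hα hα' hj
    rw [coord_of_compat hα]
    have h4 : ∑ f : Γ.Monomial 2 α, R f * F f =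
        R 0 * ∑ f : Γ.Monomial 2 α, walsh (Γ.circColor κ α) f * F f := by
      rw [Finset.mul_sum]
      refine Finset.sum_congr rfl fun f _ => ?_
      rw [h2]
      ring
    rw [h4]
    have h5 := Γ.weight_ne_zero κ α
    have h6 := Γ.weight_ne_zero κ α'
    field_simp
    linear_combination (∑ f : Γ.Monomial 2 α, walsh (Γ.circColor κ α) f * F f) * h3
  · have h2 : ∀ f, R f = 0 := by
      intro f
      -- The points `(d, true)` and `partner α (d, true)` are on one circle of `α` but have
      -- different colours, because `α'` joins the latter to `(d, false)`. So the same translation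
      -- multiplies `R` by two different signs, and `R` vanishes.
      have h3 : Γ.pointColor κ (d, true) ≠ Γ.pointColor κ (Γ.partner α (d, true)) := by
        intro h3
        apply hj
        have h4 : Γ.partner α' (d, false) = Γ.partner α (d, true) := by
          have h5 := h _ (Γ.opp_ne d)
          by_cases h6 : d ∈ α'
          · simp [partner, hd, h6, h5]
          · simp [partner, hd, h6, h5]
        rw [Γ.jump_eq_zero_iff, h3, ← h4]
        exact ((respects_iff.1 hα').2 _).symm
      have h4 := hR f (d, true) 1
      rw [← Γ.circ_partner, hR, mul_one, mul_one] at h4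
      by_contra h5
      have h6 := mul_right_cancel₀ h5 h4
      rcases zmod_two_cases (Γ.pointColor κ (d, true)) with h7 | h7 <;>
      rcases zmod_two_cases (Γ.pointColor κ (Γ.partner α (d, true))) with h8 | h8 <;>
      rw [h7, h8] at h3 h6 <;> simp [sgn_zero, sgn_one] at h3 h6 <;> norm_num at h6
    simp [h2]

/-! ### The filtered differential in coordinates -/

/-- The three corners at `x` have the same colour. -/
def MonoAt (Γ : RibbonGraph V E D) (κ : D → ZMod 2) (x : V) : Prop :=
  ∀ d, Γ.vert d = x → Γ.jump κ d = 0

theorem mem_vertexState [Fintype D] (Γ : RibbonGraph V E D) (S : Finset V) (d : D) :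
    d ∈ Γ.vertexState S ↔ Γ.vert d ∈ S := by
  simp [vertexState]

theorem agreeOff_insert (α : Finset D) (d : D) : AgreeOff d α (insert d α) := by
  intro x hx
  simp [hx]

theorem agreeOff_vertexState [LinearOrder V] [Fintype D] (Γ : RibbonGraph V E D)
    (path : ∀ x : V, Fin 3 ≃ {d : D // Γ.vert d = x}) {x : V} {T : Finset V} (hT : x ∈ T) :
    AgreeOff (path x 2 : D) (insert (path x 1 : D) (insert (path x 0 : D)
      (Γ.vertexState (T.erase x)))) (Γ.vertexState T) := by
  intro y hy
  simp only [Finset.mem_insert, mem_vertexState, Finset.mem_erase]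
  by_cases hv : Γ.vert y = x
  · obtain ⟨k, hk⟩ := (path x).surjective ⟨y, hv⟩
    have hk' : (path x k : D) = y := congrArg Subtype.val hk
    fin_cases k
    · simp [← hk', (path x 0).2, hT]
    · simp [← hk', (path x 1).2, hT]
    · exact absurd hk'.symm hy
  · have h0 : ∀ k, y ≠ path x k := fun k hk => hv (hk ▸ (path x k).2)
    simp [hv, h0]

theorem compat_vertexState_erase_iff [LinearOrder V] [Fintype D] (Γ : RibbonGraph V E D)
    (path : ∀ x : V, Fin 3 ≃ {d : D // Γ.vert d = x}) {κ : D → ZMod 2} {x : V}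
    (hx : Γ.MonoAt κ x) (T : Finset V) :
    Γ.Compat κ (Γ.vertexState (T.erase x)) ↔ Γ.Compat κ (Γ.vertexState T) := by
  by_cases hT : x ∈ T
  swap
  · rw [Finset.erase_eq_of_notMem hT]
  have hj : ∀ k, Γ.jump κ (path x k) = 0 := fun k => hx _ (path x k).2
  have h3 := Γ.agreeOff_vertexState path hT
  rw [compat_iff_of_agreeOff (agreeOff_insert _ (path x 0 : D)) (hj 0),
    compat_iff_of_agreeOff (agreeOff_insert _ (path x 1 : D)) (hj 1),
    compat_iff_of_agreeOff h3 (hj 2)]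

/-- The scalar by which the map of a vertex acts on the colourings that are constant there. -/
noncomputable def vertexScale (Γ : RibbonGraph V E D)
    (path : ∀ x : V, Fin 3 ≃ {d : D // Γ.vert d = x}) (κ : D → ZMod 2) (x : V) : ℂ :=
  ∏ k, scale (κ (path x k))

theorem vertexScale_ne_zero (Γ : RibbonGraph V E D)
    (path : ∀ x : V, Fin 3 ≃ {d : D // Γ.vert d = x}) (κ : D → ZMod 2) (x : V) :
    Γ.vertexScale path κ x ≠ 0 :=
  Finset.prod_ne_zero_iff.2 fun _ _ => scale_ne_zero _

theorem prod_vertexScale_ne_zero (Γ : RibbonGraph V E D)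
    (path : ∀ x : V, Fin 3 ≃ {d : D // Γ.vert d = x}) (κ : D → ZMod 2) (S : Finset V) :
    ∏ x ∈ S, Γ.vertexScale path κ x ≠ 0 :=
  Finset.prod_ne_zero_iff.2 fun _ _ => Γ.vertexScale_ne_zero path κ _

/-- A product of three diagonal maps, in which one half-edge with a jump suffices to give zero. The
result does not depend on the order of the half-edges. -/
theorem coord_vertexMap [LinearOrder V] [Fintype D] (Γ : RibbonGraph V E D)
    (path : ∀ x : V, Fin 3 ≃ {d : D // Γ.vert d = x}) (κ : D → ZMod 2) {x : V} {T : Finset V}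
    (hT : x ∈ T) (F : Γ.StateSpace 2 (Γ.vertexState (T.erase x))) :
    Γ.coord κ (Γ.vertexState T)
        (Γ.vertexMap 2 (T.erase x) T (fun k => (path x k : D)) F) =
      if Γ.MonoAt κ x then
        Γ.vertexScale path κ x * Γ.coord κ (Γ.vertexState (T.erase x)) F
      else 0 := by
  have hne : ∀ k l, k ≠ l → (path x k : D) ≠ path x l := fun k l hkl h =>
    hkl ((path x).injective (Subtype.ext h))
  have hv : ∀ k, Γ.vert (path x k) = x := fun k => (path x k).2
  have h0 : (path x 0 : D) ∉ Γ.vertexState (T.erase x) := by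
    simp [mem_vertexState, hv]
  have h1 : (path x 1 : D) ∉ insert (path x 0 : D) (Γ.vertexState (T.erase x)) := by
    simp [mem_vertexState, hv, hne 1 0 (by decide)]
  have h2 : (path x 2 : D) ∉ insert (path x 1 : D) (insert (path x 0 : D)
      (Γ.vertexState (T.erase x))) := by
    simp [mem_vertexState, hv, hne 2 0 (by decide), hne 2 1 (by decide)]
  have h2' : (path x 2 : D) ∈ Γ.vertexState T := by simp [mem_vertexState, hv, hT]
  have h3 := Γ.agreeOff_vertexState path hT
  have hmono : Γ.MonoAt κ x ↔ ∀ k, Γ.jump κ (path x k) = 0 := by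
    constructor
    · exact fun h k => h _ (hv k)
    · intro h d hd
      obtain ⟨k, hk⟩ := (path x).surjective ⟨d, hd⟩
      have := h k
      rwa [hk] at this
  unfold vertexMap
  rw [LinearMap.comp_apply, LinearMap.comp_apply,
    Γ.coord_edgeMap κ h3 (iff_of_false h2 (not_not.2 h2')),
    Γ.coord_edgeMap κ (agreeOff_insert _ _)
      (iff_of_false h1 (not_not.2 (Finset.mem_insert_self _ _))),
    Γ.coord_edgeMap κ (agreeOff_insert _ _)
      (iff_of_false h0 (not_not.2 (Finset.mem_insert_self _ _)))]
  simp only [hmono, Fin.forall_fin_succ, vertexScale, Fin.prod_univ_three]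
  by_cases j0 : Γ.jump κ (path x 0) = 0 <;> by_cases j1 : Γ.jump κ (path x 1) = 0 <;>
    by_cases j2 : Γ.jump κ (path x 2) = 0 <;> simp [j0, j1, j2]
  ring

/-- The normalized coordinate of a chain at the vertex state `S` with respect to the colouring
`κ`. -/
noncomputable def chainCoord [LinearOrder V] [Fintype D] (Γ : RibbonGraph V E D)
    (path : ∀ x : V, Fin 3 ≃ {d : D // Γ.vert d = x}) (κ : D → ZMod 2) (S : Finset V) :
    Γ.Chain 2 →ₗ[ℂ] ℂ :=
  (∏ x ∈ S, Γ.vertexScale path κ x)⁻¹ • (Γ.coord κ (Γ.vertexState S) ∘ₗ LinearMap.proj S)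

section Differential

variable [LinearOrder V] [Fintype D] (Γ : RibbonGraph V E D)
  (path : ∀ x : V, Fin 3 ≃ {d : D // Γ.vert d = x})

theorem chainCoord_apply (κ : D → ZMod 2) (S : Finset V) (c : Γ.Chain 2) :
    Γ.chainCoord path κ S c =
      (∏ x ∈ S, Γ.vertexScale path κ x)⁻¹ * Γ.coord κ (Γ.vertexState S) (c S) := rfl

theorem chainCoord_of_not_compat {κ : D → ZMod 2} {S : Finset V}
    (h : ¬ Γ.Compat κ (Γ.vertexState S)) (c : Γ.Chain 2) : Γ.chainCoord path κ S c = 0 := by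
  rw [chainCoord_apply, coord_of_not_compat h, mul_zero]

theorem apply_eq_zero_of_chainCoord {S : Finset V} {c : Γ.Chain 2}
    (h : ∀ κ, Γ.chainCoord path κ S c = 0) : c S = 0 := by
  refine Γ.eq_zero_of_coord_eq_zero _ _ fun κ => ?_
  have := h κ
  rw [chainCoord_apply] at this
  exact (mul_eq_zero.1 this).resolve_left
    (inv_ne_zero (Γ.prod_vertexScale_ne_zero path κ S))

theorem chain_ext {c c' : Γ.Chain 2}
    (h : ∀ κ S, Γ.chainCoord path κ S c = Γ.chainCoord path κ S c') : c = c' := by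
  rw [← sub_eq_zero]
  funext S
  refine Γ.apply_eq_zero_of_chainCoord path fun κ => ?_
  rw [map_sub, h, sub_self]

theorem exists_chainCoord_eq (a : (D → ZMod 2) → Finset V → ℂ)
    (ha : ∀ κ S, ¬ Γ.Compat κ (Γ.vertexState S) → a κ S = 0) :
    ∃ c : Γ.Chain 2, ∀ κ S, Γ.chainCoord path κ S c = a κ S := by
  choose F hF using fun S : Finset V => Γ.exists_coord_eq (Γ.vertexState S)
    (fun κ => (∏ x ∈ S, Γ.vertexScale path κ x) * a κ S)
    (fun κ hκ => by rw [ha κ S hκ, mul_zero])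
  refine ⟨F, fun κ S => ?_⟩
  rw [chainCoord_apply, hF, inv_mul_cancel_left₀ (Γ.prod_vertexScale_ne_zero path κ S)]

theorem mem_chainDegree_iff {i : ℕ} {c : Γ.Chain 2} :
    c ∈ Γ.chainDegree 2 i ↔ ∀ κ S, S.card ≠ i → Γ.chainCoord path κ S c = 0 := by
  constructor
  · intro h κ S hS
    rw [chainCoord_apply, h S hS, map_zero, mul_zero]
  · intro h S hS
    exact Γ.apply_eq_zero_of_chainCoord path fun κ => h κ S hS

/-- The sign of the edge of the hypercube that ends at `T` and changes `x`. -/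
def edgeSign (T : Finset V) (x : V) : ℂ := (-1) ^ (T.filter (· < x)).card

/-- Normalizing by the scalars of the vertices of the state turns every diagonal entry into `0` or
`1`, so only the signs of the hypercube are left. -/
theorem chainCoord_differential (κ : D → ZMod 2) (T : Finset V) (c : Γ.Chain 2) :
    Γ.chainCoord path κ T (Γ.filteredDifferential 2 path c) =
      ∑ x ∈ T, edgeSign T x *
        if Γ.MonoAt κ x then Γ.chainCoord path κ (T.erase x) c else 0 := by
  rw [chainCoord_apply]
  simp only [filteredDifferential, LinearMap.pi_apply, LinearMap.sum_apply, LinearMap.smul_apply,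
    LinearMap.comp_apply, LinearMap.proj_apply, map_sum, map_smul, smul_eq_mul, Finset.mul_sum]
  refine Finset.sum_congr rfl fun x hx => ?_
  rw [Γ.coord_vertexMap path κ hx, mul_left_comm]
  unfold edgeSign
  congr 1
  split_ifs
  · rw [chainCoord_apply, ← Finset.mul_prod_erase T _ hx, mul_inv]
    have := Γ.vertexScale_ne_zero path κ x
    field_simp
  · rw [mul_zero]

theorem edgeSign_mul_edgeSign_of_lt {T : Finset V} {x y : V} (hx : x ∈ T) (hxy : x < y) :
    edgeSign T y * edgeSign (T.erase y) x = -(edgeSign T x * edgeSign (T.erase x) y) := by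
  have h1 : (T.erase y).filter (· < x) = T.filter (· < x) := by
    ext z
    simp only [Finset.mem_filter, Finset.mem_erase]
    exact ⟨fun h => ⟨h.1.2, h.2⟩, fun h => ⟨⟨(h.2.trans hxy).ne, h.1⟩, h.2⟩⟩
  have h2 : T.filter (· < y) = insert x ((T.erase x).filter (· < y)) := by
    ext z
    simp only [Finset.mem_filter, Finset.mem_erase, Finset.mem_insert]
    by_cases hz : z = x
    · subst hz
      simp [hx, hxy]
    · simp [hz]
  have h3 : (T.filter (· < y)).card = ((T.erase x).filter (· < y)).card + 1 := by
    rw [h2, Finset.card_insert_of_notMem (by simp)]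
  unfold edgeSign
  rw [h1, h3, pow_succ]
  ring

theorem edgeSign_mul_edgeSign {T : Finset V} {x y : V} (hx : x ∈ T) (hy : y ∈ T) (hxy : x ≠ y) :
    edgeSign T y * edgeSign (T.erase y) x = -(edgeSign T x * edgeSign (T.erase x) y) := by
  rcases lt_or_gt_of_ne hxy with h | h
  · exact edgeSign_mul_edgeSign_of_lt hx h
  · rw [edgeSign_mul_edgeSign_of_lt hy h, neg_neg]

theorem filteredDifferential_comp_self :
    Γ.filteredDifferential 2 path ∘ₗ Γ.filteredDifferential 2 path = 0 := by
  ext1 c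
  refine Γ.chain_ext path fun κ T => ?_
  rw [LinearMap.comp_apply, LinearMap.zero_apply, map_zero, chainCoord_differential]
  -- The double sum runs over ordered pairs of removed vertices; `a` is antisymmetric because the
  -- two orders carry opposite signs, so the sum equals its own negative.
  let a : V → V → ℂ := fun x y => if x = y then 0 else
    edgeSign T x * edgeSign (T.erase x) y * if Γ.MonoAt κ x ∧ Γ.MonoAt κ y then
      Γ.chainCoord path κ ((T.erase x).erase y) c else 0
  have h1 : ∀ x ∈ T, (edgeSign T x * if Γ.MonoAt κ x then
      Γ.chainCoord path κ (T.erase x) (Γ.filteredDifferential 2 path c) else 0) =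
      ∑ y ∈ T, a x y := by
    intro x hx
    rw [← Finset.add_sum_erase T _ hx, chainCoord_differential]
    have : a x x = 0 := if_pos rfl
    rw [this, zero_add]
    split_ifs with hm
    · rw [Finset.mul_sum]
      refine Finset.sum_congr rfl fun y hy => ?_
      simp only [a]
      rw [if_neg (Finset.ne_of_mem_erase hy).symm]
      simp only [hm, true_and, mul_assoc]
    · rw [mul_zero]
      refine (Finset.sum_eq_zero fun y _ => ?_).symm
      simp [a, hm]
  rw [Finset.sum_congr rfl h1]
  have h2 : ∑ x ∈ T, ∑ y ∈ T, a x y = -∑ x ∈ T, ∑ y ∈ T, a x y := by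
    conv_lhs => rw [Finset.sum_comm]
    rw [← Finset.sum_neg_distrib]
    refine Finset.sum_congr rfl fun y hy => ?_
    rw [← Finset.sum_neg_distrib]
    refine Finset.sum_congr rfl fun x hx => ?_
    simp only [a]
    by_cases hxy : x = y
    · simp [hxy]
    · rw [if_neg hxy, if_neg (Ne.symm hxy), edgeSign_mul_edgeSign hy hx (Ne.symm hxy),
        Finset.erase_right_comm]
      by_cases m1 : Γ.MonoAt κ x <;> by_cases m2 : Γ.MonoAt κ y <;> simp [m1, m2]
  exact self_eq_neg.1 h2

end Differential

/-! ### The cohomology in degree one -/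

/-- The colourings of the circles of the vertex states with a single 1-smoothing for which no
vertex has three corners of the same colour. -/
abbrev HarmonicColoring [Fintype D] (Γ : RibbonGraph V E D) : Type _ :=
  {q : (D → ZMod 2) × V // Γ.Compat q.1 (Γ.vertexState {q.2}) ∧ ∀ x, ¬ Γ.MonoAt q.1 x}

theorem compat_singleton_iff [LinearOrder V] [Fintype D] (Γ : RibbonGraph V E D)
    (path : ∀ x : V, Fin 3 ≃ {d : D // Γ.vert d = x}) {κ : D → ZMod 2} {x : V}
    (hx : Γ.MonoAt κ x) :
    Γ.Compat κ (Γ.vertexState {x}) ↔ Γ.Compat κ (Γ.vertexState ∅) := by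
  rw [← Γ.compat_vertexState_erase_iff path hx {x}, Finset.erase_singleton]

section DegreeOne

variable [LinearOrder V] [Fintype D] (Γ : RibbonGraph V E D)
  (path : ∀ x : V, Fin 3 ≃ {d : D // Γ.vert d = x})

theorem edgeSign_singleton (x : V) : edgeSign {x} x = 1 := by
  simp [edgeSign, Finset.filter_singleton]

/-- This is the cocycle condition at the state `{v, w}`, where the two edges carry opposite signs.
-/
theorem chainCoord_cocycle {c : Γ.Chain 2} (hc : Γ.filteredDifferential 2 path c = 0)
    (κ : D → ZMod 2) {v w : V} (hvw : v ≠ w) (hv : Γ.MonoAt κ v) :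
    Γ.chainCoord path κ {w} c = if Γ.MonoAt κ w then Γ.chainCoord path κ {v} c else 0 := by
  have h1 := Γ.chainCoord_differential path κ {v, w} c
  have e1 : ({v, w} : Finset V).erase v = {w} := Finset.erase_insert (by simpa using hvw)
  have e2 : ({v, w} : Finset V).erase w = {v} := by
    rw [Finset.pair_comm]
    exact Finset.erase_insert (by simpa using hvw.symm)
  have h2 : edgeSign {v, w} w = -edgeSign {v, w} v := by
    have := edgeSign_mul_edgeSign (T := {v, w}) (x := v) (y := w) (by simp) (by simp) hvw
    rwa [e1, e2, edgeSign_singleton, edgeSign_singleton, mul_one, mul_one] at this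
  rw [hc, map_zero, Finset.sum_pair hvw, e1, e2, h2, if_pos hv] at h1
  have h3 : edgeSign {v, w} v ≠ 0 := pow_ne_zero _ (by norm_num)
  have h4 : edgeSign {v, w} v * (Γ.chainCoord path κ {w} c -
      if Γ.MonoAt κ w then Γ.chainCoord path κ {v} c else 0) = 0 := by
    rw [mul_sub, sub_eq_add_neg, ← neg_mul]
    exact h1.symm
  exact sub_eq_zero.1 ((mul_eq_zero.1 h4).resolve_left h3)

theorem chainCoord_differential_singleton (c : Γ.Chain 2) (κ : D → ZMod 2) (x : V) :
    Γ.chainCoord path κ {x} (Γ.filteredDifferential 2 path c) =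
      if Γ.MonoAt κ x then Γ.chainCoord path κ ∅ c else 0 := by
  rw [chainCoord_differential, Finset.sum_singleton, edgeSign_singleton, one_mul,
    Finset.erase_singleton]

/-- The coordinates of a cocycle at the harmonic colourings. -/
noncomputable def harmonicPart : Γ.cocycles 2 path 1 →ₗ[ℂ] (Γ.HarmonicColoring → ℂ) :=
  LinearMap.pi fun q => Γ.chainCoord path q.1.1 {q.1.2} ∘ₗ Submodule.subtype _

/-- The differential only sees colourings with a unicoloured vertex, so any chain in degree one
supported on harmonic colourings is a cocycle. -/
theorem harmonicPart_surjective : Function.Surjective (Γ.harmonicPart path) := by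
  intro a
  obtain ⟨c, hc⟩ := Γ.exists_chainCoord_eq path
    (fun κ S => if h : ∃ q : Γ.HarmonicColoring, q.1.1 = κ ∧ {q.1.2} = S then a h.choose else 0) (by
      intro κ S hκ
      refine dif_neg ?_
      rintro ⟨q, rfl, rfl⟩
      exact hκ q.2.1)
  have hc0 : ∀ κ S, (∃ x, Γ.MonoAt κ x) → Γ.chainCoord path κ S c = 0 := by
    rintro κ S ⟨x, hx⟩
    rw [hc]
    refine dif_neg ?_
    rintro ⟨q, rfl, -⟩
    exact q.2.2 x hx
  have hmem : c ∈ Γ.cocycles 2 path 1 := by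
    refine Submodule.mem_inf.2 ⟨(Γ.mem_chainDegree_iff path).2 ?_, LinearMap.mem_ker.2 ?_⟩
    · intro κ S hS
      rw [hc]
      refine dif_neg ?_
      rintro ⟨q, -, rfl⟩
      exact hS (Finset.card_singleton _)
    · refine Γ.chain_ext path fun κ T => ?_
      rw [chainCoord_differential, map_zero]
      refine Finset.sum_eq_zero fun x _ => ?_
      split_ifs with hx
      · rw [hc0 κ _ ⟨x, hx⟩, mul_zero]
      · rw [mul_zero]
  refine ⟨⟨c, hmem⟩, ?_⟩
  funext q
  have h1 : ∃ q' : Γ.HarmonicColoring, q'.1.1 = q.1.1 ∧ ({q'.1.2} : Finset V) = {q.1.2} :=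
    ⟨q, rfl, rfl⟩
  have h2 : h1.choose = q :=
    Subtype.ext (Prod.ext h1.choose_spec.1 (Finset.singleton_injective h1.choose_spec.2))
  change Γ.chainCoord path q.1.1 {q.1.2} c = a q
  rw [hc, dif_pos h1, h2]

theorem ker_harmonicPart :
    LinearMap.ker (Γ.harmonicPart path) =
      (Γ.coboundaries 2 path 1).submoduleOf (Γ.cocycles 2 path 1) := by
  ext c
  rw [LinearMap.mem_ker, Submodule.submoduleOf, Submodule.mem_comap]
  constructor
  · intro h
    have hq : ∀ q : Γ.HarmonicColoring, Γ.chainCoord path q.1.1 {q.1.2} c.1 = 0 :=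
      fun q => congrFun h q
    obtain ⟨hc1, hc2⟩ := Submodule.mem_inf.1 c.2
    rw [LinearMap.mem_ker] at hc2
    -- The primitive: its coordinate at the empty state is that of the cocycle at `{v}` for some
    -- unicoloured vertex `v`. The choice is immaterial by `chainCoord_cocycle`.
    obtain ⟨b, hb⟩ := Γ.exists_chainCoord_eq path
      (fun κ S => if h : S = ∅ ∧ ∃ x, Γ.MonoAt κ x then
        Γ.chainCoord path κ {h.2.choose} c.1 else 0) (by
        intro κ S hκ
        split_ifs with h
        · refine Γ.chainCoord_of_not_compat path ?_ _
          rw [Γ.compat_singleton_iff path h.2.choose_spec]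
          rwa [h.1] at hκ
        · rfl)
    refine ⟨b, (Γ.mem_chainDegree_iff path).2 ?_, ?_⟩
    · intro κ S hS
      rw [hb]
      exact dif_neg fun h => hS (by rw [h.1, Finset.card_empty])
    · refine Γ.chain_ext path fun κ T => ?_
      by_cases hT : T.card = 1
      · obtain ⟨w, rfl⟩ := Finset.card_eq_one.1 hT
        rw [chainCoord_differential_singleton, Submodule.subtype_apply]
        by_cases hm : ∃ x, Γ.MonoAt κ x
        · rw [hb, dif_pos ⟨rfl, hm⟩]
          by_cases hw : hm.choose = w
          · have := hm.choose_spec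
            rw [hw] at this
            rw [if_pos this, hw]
          · rw [Γ.chainCoord_cocycle path hc2 κ hw hm.choose_spec]
        · rw [if_neg fun h => hm ⟨w, h⟩]
          by_cases hκ : Γ.Compat κ (Γ.vertexState {w})
          · exact (hq ⟨(κ, w), hκ, not_exists.1 hm⟩).symm
          · exact (Γ.chainCoord_of_not_compat path hκ _).symm
      · rw [chainCoord_differential, Submodule.subtype_apply,
          (Γ.mem_chainDegree_iff path).1 hc1 κ T hT]
        refine Finset.sum_eq_zero fun x hx => ?_
        have hne : T.erase x ≠ ∅ := by
          intro he
          apply hT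
          rw [← Finset.insert_erase hx, he, insert_empty_eq, Finset.card_singleton]
        rw [hb, dif_neg fun h => hne h.1, ite_self, mul_zero]
  · rintro ⟨b, -, hb⟩
    funext q
    change Γ.chainCoord path q.1.1 {q.1.2} c.1 = 0
    rw [Submodule.subtype_apply] at hb
    rw [← hb, chainCoord_differential_singleton, if_neg (q.2.2 _)]

/-- The cohomology in degree one has a basis that is indexed by the harmonic colourings. -/
noncomputable def homologyEquiv :
    Γ.FilteredVertexHomology 2 path 1 ≃ₗ[ℂ] (Γ.HarmonicColoring → ℂ) :=
  (Submodule.quotEquivOfEq _ _ (Γ.ker_harmonicPart path).symm).trans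
    ((Γ.harmonicPart path).quotKerEquivOfSurjective (Γ.harmonicPart_surjective path))

theorem finrank_homology [Finite V] :
    Module.finrank ℂ (Γ.FilteredVertexHomology 2 path 1) = Nat.card Γ.HarmonicColoring := by
  have := Fintype.ofFinite Γ.HarmonicColoring
  rw [(Γ.homologyEquiv path).finrank_eq, Module.finrank_fintype_fun_eq_card,
    Nat.card_eq_fintype_card]

theorem subsingleton_homology [IsEmpty Γ.HarmonicColoring] :
    Subsingleton (Γ.FilteredVertexHomology 2 path 1) :=
  (Γ.homologyEquiv path).toEquiv.subsingleton

end DegreeOne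

/-! ### Half-edges -/

theorem vert_rot (Γ : RibbonGraph V E D) (d : D) : Γ.vert (Γ.rot d) = Γ.vert d :=
  ((Γ.vert_eq_iff _ _).2 ⟨1, by simp⟩).symm

theorem vert_rot_symm (Γ : RibbonGraph V E D) (d : D) : Γ.vert (Γ.rot.symm d) = Γ.vert d := by
  rw [← Γ.vert_rot, Equiv.apply_symm_apply]

/-- A function on the half-edges that is invariant under the rotation is a function of the
vertex. -/
theorem exists_eq_vert [Finite D] (Γ : RibbonGraph V E D) (f : D → X)
    (hf : ∀ d, f d = f (Γ.rot.symm d)) : ∃ φ : V → X, ∀ d, f d = φ (Γ.vert d) := by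
  have hrot : ∀ d, f (Γ.rot d) = f d := fun d => by rw [hf (Γ.rot d), Equiv.symm_apply_apply]
  have hpow : ∀ (n : ℕ) d, f ((Γ.rot ^ n) d) = f d := by
    intro n
    induction n with
    | zero => simp
    | succ n ih =>
      intro d
      rw [pow_succ', Equiv.Perm.mul_apply, hrot, ih]
  have hvert : ∀ d d', Γ.vert d = Γ.vert d' → f d = f d' := by
    intro d d' h
    obtain ⟨n, hn⟩ := ((Γ.vert_eq_iff d d').1 h).exists_nat_pow_eq
    rw [← hn, hpow]
  refine ⟨fun x => f (Function.surjInv Γ.vert_surjective x), fun d => hvert _ _ ?_⟩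
  exact (Function.surjInv_eq Γ.vert_surjective _).symm

/-- A half of an edge. -/
noncomputable def halfOf (Γ : RibbonGraph V E D) (e : E) : D :=
  Function.surjInv Γ.edge_surjective e

theorem edge_halfOf (Γ : RibbonGraph V E D) (e : E) : Γ.edge (Γ.halfOf e) = e :=
  Function.surjInv_eq _ e

theorem eq_halfOf_or (Γ : RibbonGraph V E D) (d : D) :
    d = Γ.halfOf (Γ.edge d) ∨ d = Γ.opp (Γ.halfOf (Γ.edge d)) :=
  (Γ.edge_eq_iff _ _).1 (Γ.edge_halfOf _)

theorem sum_halfOf [Fintype D] [Fintype E] {A : Type*} [AddCommMonoid A] (Γ : RibbonGraph V E D)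
    (f : D → A) : ∑ d, f d = ∑ e, (f (Γ.halfOf e) + f (Γ.opp (Γ.halfOf e))) := by
  rw [← Finset.sum_fiberwise Finset.univ Γ.edge f]
  refine Finset.sum_congr rfl fun e _ => ?_
  have h : (Finset.univ.filter fun d => Γ.edge d = e) =
      {Γ.halfOf e, Γ.opp (Γ.halfOf e)} := by
    ext d
    simp only [Finset.mem_filter, Finset.mem_univ, true_and, Finset.mem_insert,
      Finset.mem_singleton]
    constructor
    · rintro rfl
      exact Γ.eq_halfOf_or d
    · rintro (rfl | rfl)
      · exact Γ.edge_halfOf e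
      · rw [Γ.edge_opp, Γ.edge_halfOf]
  rw [h, Finset.sum_pair (Γ.opp_ne _).symm]

theorem sum_rot_symm [Fintype D] (Γ : RibbonGraph V E D) (f : D → ZMod 2) (x : V) :
    ∑ d with Γ.vert d = x, f (Γ.rot.symm d) = ∑ d with Γ.vert d = x, f d := by
  refine Finset.sum_bij' (fun d _ => Γ.rot.symm d) (fun d _ => Γ.rot d) ?_ ?_ ?_ ?_ ?_ <;>
    simp [vert_rot, vert_rot_symm]

/-- Every corner at `x` lies between two consecutive half-edges and is counted twice. -/
theorem sum_jump [Fintype D] (Γ : RibbonGraph V E D) (κ : D → ZMod 2) (x : V) :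
    ∑ d with Γ.vert d = x, Γ.jump κ d = 0 := by
  unfold jump
  rw [Finset.sum_add_distrib, Γ.sum_rot_symm, zmod_two_add_self]

theorem sum_path [Fintype D] (Γ : RibbonGraph V E D) {A : Type*} [AddCommMonoid A]
    (path : ∀ x : V, Fin 3 ≃ {d : D // Γ.vert d = x}) (f : D → A) (x : V) :
    ∑ d with Γ.vert d = x, f d = ∑ k, f (path x k) := by
  rw [Equiv.sum_comp (path x) (fun d => f d.1)]
  exact (Finset.sum_subtype _ (by simp) f)

theorem pointColor_xor (Γ : RibbonGraph V E D) (κ : D → ZMod 2) (d : D) (s t : Bool) :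
    Γ.pointColor κ (d, s ^^ t) = Γ.pointColor κ (d, s) + if t then Γ.jump κ d else 0 := by
  have h : κ d + Γ.jump κ d = κ (Γ.rot.symm d) := by
    rw [jump, ← add_assoc, zmod_two_add_self, zero_add]
  have h' : κ (Γ.rot.symm d) + Γ.jump κ d = κ d := by
    rw [jump, add_left_comm, zmod_two_add_self, add_zero]
  cases s <;> cases t <;> simp [pointColor, h, h']

/-- The two strands of the band carry the colours on the sides of `d` to the sides of `opp d`,
possibly interchanged, which does not affect their sum. -/
theorem jump_opp {Γ : RibbonGraph V E D} {κ : D → ZMod 2} {α : Finset D} (h : Γ.Compat κ α)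
    (d : D) : Γ.jump κ (Γ.opp d) = Γ.jump κ d := by
  have h1 := (respects_iff.1 h).2 (d, true)
  have h2 := (respects_iff.1 h).2 (d, false)
  simp only [partner] at h1 h2
  have h3 : ∀ (s : Bool), Γ.jump κ (Γ.opp d) =
      Γ.pointColor κ (Γ.opp d, s) + Γ.pointColor κ (Γ.opp d, !s) := by
    intro s
    cases s
    · exact add_comm _ _
    · rfl
  rw [h3 (!(true ^^ Γ.twist (Γ.edge d) ^^ decide (d ∈ α) ^^ decide (Γ.opp d ∈ α))), ← h1]
  have h4 : (!!(true ^^ Γ.twist (Γ.edge d) ^^ decide (d ∈ α) ^^ decide (Γ.opp d ∈ α))) =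
      !(false ^^ Γ.twist (Γ.edge d) ^^ decide (d ∈ α) ^^ decide (Γ.opp d ∈ α)) := by
    simp
  rw [h4, ← h2]
  rfl

/-- The indicator function of a set of vertices. -/
noncomputable def ind (S : Finset V) (x : V) : ZMod 2 := if x ∈ S then 1 else 0

/-- Two colourings of the corners that differ by a function of the vertex: if one of them is
compatible with a vertex state, when is the other one compatible with another vertex state? -/
theorem compat_add_iff [Fintype D] {Γ : RibbonGraph V E D} {κ₀ κ : D → ZMod 2} {S₀ S : Finset V}
    {φ : V → ZMod 2} (h₀ : Γ.Compat κ₀ (Γ.vertexState S₀))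
    (hκ : ∀ d, κ d = κ₀ d + φ (Γ.vert d)) :
    Γ.Compat κ (Γ.vertexState S) ↔ ∀ d, φ (Γ.vert d) + φ (Γ.vert (Γ.opp d)) =
      Γ.jump κ₀ d * (ind S (Γ.vert d) + ind S (Γ.vert (Γ.opp d)) + ind S₀ (Γ.vert d) +
        ind S₀ (Γ.vert (Γ.opp d))) := by
  have hp : ∀ d s, Γ.pointColor κ (d, s) = Γ.pointColor κ₀ (d, s) + φ (Γ.vert d) := by
    intro d s
    cases s
    · simp [pointColor_false, hκ, vert_rot_symm]
    · simp [pointColor_true, hκ]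
  have key : ∀ d s, Γ.pointColor κ (d, s) =
      Γ.pointColor κ (Γ.partner (Γ.vertexState S) (d, s)) ↔
      φ (Γ.vert d) + φ (Γ.vert (Γ.opp d)) =
      Γ.jump κ₀ d * (ind S (Γ.vert d) + ind S (Γ.vert (Γ.opp d)) + ind S₀ (Γ.vert d) +
        ind S₀ (Γ.vert (Γ.opp d))) := by
    intro d s
    have h1 := (respects_iff.1 h₀).2 (d, s)
    -- The parity of the change in the number of crossings on the edge between `S₀` and `S`. An odd
    -- change swaps the sides at `opp d` and so adds the jump to the colour.
    let t : Bool := decide (Γ.vert d ∈ S) ^^ decide (Γ.vert (Γ.opp d) ∈ S) ^^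
      decide (Γ.vert d ∈ S₀) ^^ decide (Γ.vert (Γ.opp d) ∈ S₀)
    have h2 : Γ.partner (Γ.vertexState S) (d, s) =
        (Γ.opp d, (Γ.partner (Γ.vertexState S₀) (d, s)).2 ^^ t) := by
      simp only [partner, mem_vertexState, t]
      cases decide (Γ.vert d ∈ S₀) <;> cases decide (Γ.vert (Γ.opp d) ∈ S₀) <;> simp
    have h3 : (if t then Γ.jump κ₀ d else 0) =
        Γ.jump κ₀ d * (ind S (Γ.vert d) + ind S (Γ.vert (Γ.opp d)) + ind S₀ (Γ.vert d) +
        ind S₀ (Γ.vert (Γ.opp d))) := by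
      have h2' : (1 : ZMod 2) + 1 = 0 := by decide
      by_cases a1 : Γ.vert d ∈ S <;> by_cases a2 : Γ.vert (Γ.opp d) ∈ S <;>
        by_cases a3 : Γ.vert d ∈ S₀ <;> by_cases a4 : Γ.vert (Γ.opp d) ∈ S₀ <;>
        simp [t, ind, a1, a2, a3, a4, h2']
    have h4 : Γ.partner (Γ.vertexState S₀) (d, s) =
        (Γ.opp d, (Γ.partner (Γ.vertexState S₀) (d, s)).2) := rfl
    have h5 : ∀ a b j : ZMod 2, a = j + b ↔ a + b = j := by decide
    rw [h2, hp, hp, pointColor_xor, ← h4, ← h1, jump_opp h₀, h3, add_assoc, add_right_inj]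
    exact h5 _ _ _
  rw [Compat, respects_iff]
  constructor
  · exact fun h d => (key d true).1 (h.2 _)
  · refine fun h => ⟨fun d => ?_, fun p => (key p.1 p.2).2 (h _)⟩
    simp [pointColor]

/-! ### Walks -/

theorem reflTransGen_const {Y : Type*} {r : Y → Y → Prop} {f : Y → X}
    (h : ∀ x y, r x y → f x = f y) {x y : Y} (hxy : Relation.ReflTransGen r x y) : f x = f y := by
  induction hxy with
  | refl => rfl
  | tail _ h1 ih => rw [ih, h _ _ h1]

theorem eq_of_connected {Γ : RibbonGraph V E D} (hconn : IsConnectedGraph Γ.graph) {φ : V → X}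
    (h : ∀ d, φ (Γ.vert d) = φ (Γ.vert (Γ.opp d))) (x y : V) : φ x = φ y := by
  refine reflTransGen_const ?_ (hconn.2 x trivial y trivial)
  rintro x y ⟨e, d, -, rfl, rfl⟩
  exact h d

theorem deleteEdges_adj_iff (Γ : RibbonGraph V E D) (e : E) (x y : V) :
    (Γ.graph.deleteEdges {e}).Adj x y ↔
      ∃ d, Γ.edge d ≠ e ∧ Γ.vert d = x ∧ Γ.vert (Γ.opp d) = y := by
  constructor
  · rintro ⟨e', ⟨d, rfl, h1, h2⟩, h3⟩
    exact ⟨d, h3, h1, h2⟩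
  · rintro ⟨d, h1, h2, h3⟩
    exact ⟨Γ.edge d, ⟨d, rfl, h2, h3⟩, h1⟩

theorem reflTransGen_deleteEdges_symm (Γ : RibbonGraph V E D) (e : E) {x y : V}
    (h : Relation.ReflTransGen (Γ.graph.deleteEdges {e}).Adj x y) :
    Relation.ReflTransGen (Γ.graph.deleteEdges {e}).Adj y x := by
  induction h with
  | refl => exact .refl
  | tail _ h1 ih => exact .head h1.symm ih

theorem isBridge_iff (Γ : RibbonGraph V E D) (d : D) :
    IsBridge Γ.graph (Γ.edge d) ↔ ¬ Relation.ReflTransGen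
      (Γ.graph.deleteEdges {Γ.edge d}).Adj (Γ.vert d) (Γ.vert (Γ.opp d)) := by
  constructor
  · rintro ⟨x, y, ⟨d', h1, rfl, rfl⟩, h2⟩ h3
    apply h2
    rcases (Γ.edge_eq_iff d d').1 h1.symm with rfl | rfl
    · exact h3
    · rw [Γ.opp_opp]
      exact Γ.reflTransGen_deleteEdges_symm _ h3
  · exact fun h => ⟨_, _, ⟨d, rfl, rfl, rfl⟩, h⟩

/-! ### Perfect matchings -/

/-- Counting half-edges excludes loops automatically, since both halves of a loop are at the same
vertex. -/
theorem isPerfectMatching_iff (Γ : RibbonGraph V E D) (M : Set E) :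
    IsPerfectMatching Γ.graph M ↔ ∀ x, ∃! d, Γ.vert d = x ∧ Γ.edge d ∈ M := by
  constructor
  · rintro ⟨-, h1, h2⟩ x
    obtain ⟨e, ⟨he, y, d, rfl, hd, -⟩, huniq⟩ := h2 x trivial
    refine ⟨d, ⟨hd, he⟩, ?_⟩
    rintro d' ⟨hd', he'⟩
    have h3 : Γ.edge d' = Γ.edge d := huniq _ ⟨he', _, d', rfl, hd', rfl⟩
    rcases (Γ.edge_eq_iff d d').1 h3.symm with rfl | rfl
    · rfl
    · exact absurd ⟨d, rfl, hd, hd'⟩ (h1 _ he x)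
  · intro h
    refine ⟨fun e _ => ?_, ?_, ?_⟩
    · exact Graph.IsLink.edge_mem (G := Γ.graph) ⟨Γ.halfOf e, Γ.edge_halfOf e, rfl, rfl⟩
    · rintro e he x ⟨d, rfl, h1, h2⟩
      exact Γ.opp_ne d ((h x).unique ⟨h2, by rwa [Γ.edge_opp]⟩ ⟨h1, he⟩)
    · intro x _
      obtain ⟨d, ⟨hd, he⟩, huniq⟩ := h x
      refine ⟨Γ.edge d, ⟨he, _, d, rfl, hd, rfl⟩, ?_⟩
      rintro e' ⟨he', y, d', rfl, hd', -⟩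
      rw [huniq d' ⟨hd', he'⟩]

/-- The indicator function of the edges that are not in `M`. -/
noncomputable def offMatching (M : Set E) (e : E) : ZMod 2 := if e ∈ M then 0 else 1

theorem offMatching_eq_zero_iff {M : Set E} {e : E} : offMatching M e = 0 ↔ e ∈ M := by
  simp [offMatching]

/-- Two of the three half-edges at a vertex are outside `M`, so the complement of `M` is a cycle
modulo two. -/
theorem sum_offMatching [Fintype D] (Γ : RibbonGraph V E D)
    (path : ∀ x : V, Fin 3 ≃ {d : D // Γ.vert d = x}) {M : Set E}
    (hM : IsPerfectMatching Γ.graph M) (x : V) :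
    ∑ d with Γ.vert d = x, offMatching M (Γ.edge d) = 0 := by
  rw [Γ.sum_path path]
  obtain ⟨d, ⟨hd, he⟩, huniq⟩ := (Γ.isPerfectMatching_iff M).1 hM x
  have h : ∃! k, offMatching M (Γ.edge (path x k)) = 0 := by
    simp only [offMatching_eq_zero_iff]
    refine ⟨(path x).symm ⟨d, hd⟩, by simpa using he, fun k hk => ?_⟩
    rw [Equiv.eq_symm_apply]
    exact Subtype.ext (huniq _ ⟨(path x k).2, hk⟩)
  have key : ∀ j : Fin 3 → ZMod 2, (∃! k, j k = 0) → ∑ k, j k = 0 := by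
    unfold ExistsUnique
    decide
  exact key _ h

/-- Of the three half-edges at a vertex whose corners have two colours, exactly one has the same
colour on both sides. -/
theorem existsUnique_jump_eq_zero [Fintype D] (Γ : RibbonGraph V E D)
    (path : ∀ x : V, Fin 3 ≃ {d : D // Γ.vert d = x}) {κ : D → ZMod 2} {x : V}
    (hx : ¬ Γ.MonoAt κ x) : ∃! d, Γ.vert d = x ∧ Γ.jump κ d = 0 := by
  have h1 := Γ.sum_jump κ x
  rw [Γ.sum_path path] at h1
  -- Three elements of `ZMod 2` with sum zero, not all zero, are `0, 1, 1` in some order.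
  have key : ∀ j : Fin 3 → ZMod 2, ∑ k, j k = 0 → (¬ ∀ k, j k = 0) → ∃! k, j k = 0 := by
    unfold ExistsUnique
    decide
  obtain ⟨k, hk, huniq⟩ := key _ h1 fun h2 => hx fun d hd => by
    have := h2 ((path x).symm ⟨d, hd⟩)
    simpa using this
  refine ⟨path x k, ⟨(path x k).2, hk⟩, ?_⟩
  rintro d ⟨hd, hj⟩
  have h3 := huniq ((path x).symm ⟨d, hd⟩) (by simpa using hj)
  rw [← h3, Equiv.apply_symm_apply]

/-- The edges with the same colour on both sides. -/
def monoEdges (Γ : RibbonGraph V E D) (κ : D → ZMod 2) : Set E :=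
  {e | ∃ d, Γ.edge d = e ∧ Γ.jump κ d = 0}

theorem mem_monoEdges_iff {Γ : RibbonGraph V E D} {κ : D → ZMod 2} {α : Finset D}
    (h : Γ.Compat κ α) (d : D) : Γ.edge d ∈ Γ.monoEdges κ ↔ Γ.jump κ d = 0 := by
  constructor
  · rintro ⟨d', h1, h2⟩
    rcases (Γ.edge_eq_iff d d').1 h1.symm with rfl | rfl
    · exact h2
    · rwa [jump_opp h] at h2
  · exact fun h1 => ⟨d, rfl, h1⟩

theorem jump_eq_offMatching {Γ : RibbonGraph V E D} {κ : D → ZMod 2} {α : Finset D}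
    (h : Γ.Compat κ α) (d : D) : Γ.jump κ d = offMatching (Γ.monoEdges κ) (Γ.edge d) := by
  unfold offMatching
  rw [mem_monoEdges_iff h]
  rcases zmod_two_cases (Γ.jump κ d) with h1 | h1 <;> simp [h1]

theorem isPerfectMatching_monoEdges [Fintype D] (Γ : RibbonGraph V E D)
    (path : ∀ x : V, Fin 3 ≃ {d : D // Γ.vert d = x}) {κ : D → ZMod 2} {α : Finset D}
    (h : Γ.Compat κ α) (hκ : ∀ x, ¬ Γ.MonoAt κ x) :
    IsPerfectMatching Γ.graph (Γ.monoEdges κ) := by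
  rw [isPerfectMatching_iff]
  intro x
  simpa only [mem_monoEdges_iff h] using Γ.existsUnique_jump_eq_zero path (hκ x)

/-- Every bridge of a trivalent graph is in every perfect matching. -/
theorem mem_of_isBridge [Fintype D] [Fintype E] [Fintype V] (Γ : RibbonGraph V E D)
    (path : ∀ x : V, Fin 3 ≃ {d : D // Γ.vert d = x}) {M : Set E}
    (hM : IsPerfectMatching Γ.graph M) {e : E} (he : IsBridge Γ.graph e) : e ∈ M := by
  have hbr := he
  rw [← Γ.edge_halfOf e, isBridge_iff, Γ.edge_halfOf] at hbr
  -- `U` is one side of the bridge. The half-edges outside `M` at the vertices of `U` are even in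
  -- number, and every edge other than `e` contributes two or none to them; `e` has exactly one half
  -- there, so it must lie in `M`.
  let U : V → Prop := Relation.ReflTransGen (Γ.graph.deleteEdges {e}).Adj (Γ.vert (Γ.halfOf e))
  have h1 : ∑ d, (if U (Γ.vert d) then offMatching M (Γ.edge d) else 0) = 0 := by
    rw [← Finset.sum_fiberwise Finset.univ Γ.vert]
    refine Finset.sum_eq_zero fun x _ => ?_
    have h2 : ∀ d ∈ Finset.univ.filter (fun d => Γ.vert d = x),
        (if U (Γ.vert d) then offMatching M (Γ.edge d) else 0) =
          if U x then offMatching M (Γ.edge d) else 0 := by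
      intro d hd
      rw [(Finset.mem_filter.1 hd).2]
    rw [Finset.sum_congr rfl h2]
    split_ifs
    · exact Γ.sum_offMatching path hM x
    · exact Finset.sum_const_zero
  rw [Γ.sum_halfOf, Finset.sum_eq_single e] at h1
  · rw [if_pos (show U (Γ.vert (Γ.halfOf e)) from Relation.ReflTransGen.refl), if_neg hbr,
      Γ.edge_halfOf, add_zero] at h1
    exact offMatching_eq_zero_iff.1 h1
  · intro e' _ hne
    have hadj : (Γ.graph.deleteEdges {e}).Adj (Γ.vert (Γ.halfOf e'))
        (Γ.vert (Γ.opp (Γ.halfOf e'))) :=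
      (Γ.deleteEdges_adj_iff _ _ _).2 ⟨_, by rwa [Γ.edge_halfOf], rfl, rfl⟩
    have h2 : U (Γ.vert (Γ.halfOf e')) ↔ U (Γ.vert (Γ.opp (Γ.halfOf e'))) :=
      ⟨fun h => h.tail hadj, fun h => h.tail hadj.symm⟩
    rw [Γ.edge_opp]
    simp only [h2]
    exact zmod_two_add_self _
  · simp

/-! ### Plane ribbon graphs -/

/-- On a sphere, every cycle modulo two is the boundary of a set of faces. -/
theorem exists_face_coloring [Fintype D] [Fintype E] [Fintype V] (Γ : RibbonGraph V E D)
    (hconn : IsConnectedGraph Γ.graph) (hplane : Γ.IsPlane) (w : E → ZMod 2)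
    (hw : ∀ x, ∑ d with Γ.vert d = x, w (Γ.edge d) = 0) :
    ∃ κ, Γ.Compat κ ∅ ∧ ∀ d, Γ.jump κ d = w (Γ.edge d) := by
  have hjump : ∀ (F : Γ.Face → ZMod 2) d, Γ.jump (Γ.cornerColor ∅ F) d =
      F (Γ.circ ∅ (d, true)) + F (Γ.circ ∅ (d, false)) := by
    intro F d
    rw [← Γ.pointColor_cornerColor ∅ F, ← Γ.pointColor_cornerColor ∅ F]
    rfl
  let δ : (Γ.Face → ZMod 2) →ₗ[ZMod 2] (E → ZMod 2) := LinearMap.pi fun e =>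
    (LinearMap.proj (Γ.circ ∅ (Γ.halfOf e, true)) : (Γ.Face → ZMod 2) →ₗ[ZMod 2] ZMod 2) +
      LinearMap.proj (Γ.circ ∅ (Γ.halfOf e, false))
  have hδ : ∀ F d, δ F (Γ.edge d) = Γ.jump (Γ.cornerColor ∅ F) d := by
    intro F d
    have h1 : δ F (Γ.edge d) = Γ.jump (Γ.cornerColor ∅ F) (Γ.halfOf (Γ.edge d)) := by
      rw [hjump]; rfl
    rw [h1]
    rcases Γ.eq_halfOf_or d with h2 | h2
    · rw [← h2]
    · conv_rhs => rw [h2]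
      rw [jump_opp (Γ.compat_cornerColor ∅ F)]
  -- The incidence matrix modulo two, in which the column of a loop vanishes. Its kernel is the
  -- cycle space, and `δ` is the boundary map from faces to edges.
  let B : Matrix V E (ZMod 2) := Matrix.of fun x e =>
    (if Γ.vert (Γ.halfOf e) = x then 1 else 0) + if Γ.vert (Γ.opp (Γ.halfOf e)) = x then 1 else 0
  have hB : ∀ u x, B.mulVec u x = ∑ d with Γ.vert d = x, u (Γ.edge d) := by
    intro u x
    rw [Finset.sum_filter, Γ.sum_halfOf]
    simp only [Matrix.mulVec, dotProduct, B, Matrix.of_apply, Γ.edge_opp, Γ.edge_halfOf, add_mul,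
      ite_mul, one_mul, zero_mul]
  have hBt : ∀ u e, B.transpose.mulVec u e =
      u (Γ.vert (Γ.halfOf e)) + u (Γ.vert (Γ.opp (Γ.halfOf e))) := by
    intro u e
    simp only [Matrix.mulVec, dotProduct, B, Matrix.of_apply, Matrix.transpose_apply, add_mul,
      ite_mul, one_mul, zero_mul, Finset.sum_add_distrib, Finset.sum_ite_eq, Finset.mem_univ,
      if_true]
  have hle : LinearMap.range δ ≤ LinearMap.ker B.mulVecLin := by
    rintro _ ⟨F, rfl⟩
    rw [LinearMap.mem_ker]
    funext x
    rw [Matrix.mulVecLin_apply, hB]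
    simp only [hδ]
    exact Γ.sum_jump _ x
  -- Without jumps, a face colouring is constant around each vertex and along each edge, hence
  -- constant by connectedness.
  have hkerδ : Module.finrank (ZMod 2) (LinearMap.ker δ) ≤ 1 := by
    have h1 : (1 : Γ.Face → ZMod 2) ∈ LinearMap.ker δ := by
      rw [LinearMap.mem_ker]
      funext e
      exact zmod_two_add_self 1
    refine finrank_le_one (⟨1, h1⟩ : LinearMap.ker δ) ?_
    rintro ⟨F, hF⟩
    rw [LinearMap.mem_ker] at hF
    have hj : ∀ d, Γ.jump (Γ.cornerColor ∅ F) d = 0 := fun d => by rw [← hδ, hF]; rfl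
    obtain ⟨φ, hφ⟩ := Γ.exists_eq_vert (Γ.cornerColor ∅ F) fun d => zmod_two_add_eq_zero.1 (hj d)
    have hpc : ∀ p, Γ.pointColor (Γ.cornerColor ∅ F) p = φ (Γ.vert p.1) := by
      rintro ⟨d, s⟩
      cases s
      · rw [← Γ.jump_eq_zero_iff.1 (hj d), pointColor_true, hφ]
      · rw [pointColor_true, hφ]
    have hconst := eq_of_connected hconn (φ := φ) fun d => by
      have h2 := (respects_iff.1 (Γ.compat_cornerColor ∅ F)).2 (d, true)
      rw [hpc, hpc] at h2
      exact h2
    obtain ⟨x₀, -⟩ := hconn.1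
    refine ⟨φ x₀, Subtype.ext ?_⟩
    funext c
    obtain ⟨p, rfl⟩ := Γ.circ_surjective ∅ c
    change φ x₀ * 1 = F (Γ.circ ∅ p)
    rw [← Γ.pointColor_cornerColor ∅ F, hpc, mul_one, hconst]
  have hkerBt : Module.finrank (ZMod 2) (LinearMap.ker B.transpose.mulVecLin) ≤ 1 := by
    have h1 : (1 : V → ZMod 2) ∈ LinearMap.ker B.transpose.mulVecLin := by
      rw [LinearMap.mem_ker]
      funext e
      rw [Matrix.mulVecLin_apply, hBt]
      exact zmod_two_add_self 1
    refine finrank_le_one (⟨1, h1⟩ : LinearMap.ker B.transpose.mulVecLin) ?_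
    rintro ⟨u, hu⟩
    rw [LinearMap.mem_ker, Matrix.mulVecLin_apply] at hu
    have hconst := eq_of_connected hconn (φ := u) fun d => by
      have h2 := congrFun hu (Γ.edge d)
      rw [hBt, Pi.zero_apply, zmod_two_add_eq_zero] at h2
      rcases Γ.eq_halfOf_or d with h3 | h3
      · rw [← h3] at h2
        exact h2
      · rw [h3, Γ.opp_opp]
        simpa only [Γ.edge_opp, Γ.edge_halfOf] using h2.symm
    obtain ⟨x₀, -⟩ := hconn.1
    refine ⟨u x₀, Subtype.ext ?_⟩
    funext x
    simp [hconst x₀ x]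
  -- Dimension count: the range of `δ` has dimension at least `F - 1`. As `B` and its transpose have
  -- equal rank, which is at least `V - 1`, the cycle space has dimension at most `E - V + 1`, and
  -- this is `F - 1` by Euler's formula.
  have h1 := LinearMap.finrank_range_add_finrank_ker δ
  have h2 := LinearMap.finrank_range_add_finrank_ker B.mulVecLin
  have h3 := LinearMap.finrank_range_add_finrank_ker B.transpose.mulVecLin
  have h4 := B.rank_transpose
  unfold Matrix.rank at h4
  rw [Module.finrank_fintype_fun_eq_card] at h1 h2 h3
  unfold IsPlane at hplane
  rw [Nat.card_eq_fintype_card, Nat.card_eq_fintype_card, Nat.card_eq_fintype_card] at hplane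
  have heq : LinearMap.range δ = LinearMap.ker B.mulVecLin :=
    Submodule.eq_of_le_of_finrank_le hle (by omega)
  have hmem : w ∈ LinearMap.range δ := by
    rw [heq, LinearMap.mem_ker]
    funext x
    rw [Matrix.mulVecLin_apply, hB, hw]
    rfl
  obtain ⟨F, rfl⟩ := hmem
  exact ⟨_, Γ.compat_cornerColor ∅ F, fun d => (hδ F d).symm⟩

/-! ### Counting the harmonic colourings -/

theorem ind_singleton_self (x : V) : ind {x} x = 1 := by simp [ind]

theorem ind_singleton_of_ne {x y : V} (h : y ≠ x) : ind {x} y = 0 := by simp [ind, h]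

theorem ind_empty (x : V) : ind ∅ x = 0 := by simp [ind]

theorem vertexState_empty [Fintype D] (Γ : RibbonGraph V E D) : Γ.vertexState ∅ = ∅ := by
  simp [vertexState]

/-- Colourings with the same bicoloured half-edges differ by a function of the vertex. -/
theorem exists_eq_add_vert [Finite D] (Γ : RibbonGraph V E D) {κ₀ κ : D → ZMod 2}
    (h : ∀ d, Γ.jump κ₀ d = Γ.jump κ d) : ∃ φ : V → ZMod 2, ∀ d, κ d = κ₀ d + φ (Γ.vert d) := by
  have key : ∀ a b a' b' : ZMod 2, a + b = a' + b' → a + a' = b + b' := by decide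
  obtain ⟨φ, hφ⟩ := Γ.exists_eq_vert (fun d => κ₀ d + κ d) fun d => key _ _ _ _ (h d)
  refine ⟨φ, fun d => ?_⟩
  rw [← hφ, ← add_assoc, zmod_two_add_self, zero_add]

theorem jump_of_eq_add_vert (Γ : RibbonGraph V E D) {κ₀ κ : D → ZMod 2} {φ : V → ZMod 2}
    (h : ∀ d, κ d = κ₀ d + φ (Γ.vert d)) (d : D) : Γ.jump κ d = Γ.jump κ₀ d := by
  rw [jump, jump, h, h, vert_rot_symm, add_add_add_comm, zmod_two_add_self, add_zero]

/-- A perfect matching of a plane graph is the set of unicoloured edges of a colouring of the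
faces. -/
theorem exists_matching_coloring [Fintype D] [Fintype E] [Fintype V] (Γ : RibbonGraph V E D)
    (path : ∀ x : V, Fin 3 ≃ {d : D // Γ.vert d = x}) (hconn : IsConnectedGraph Γ.graph)
    (hplane : Γ.IsPlane) {M : Set E} (hM : IsPerfectMatching Γ.graph M) :
    ∃ κ, Γ.Compat κ (Γ.vertexState ∅) ∧ ∀ d, Γ.jump κ d = offMatching M (Γ.edge d) := by
  rw [vertexState_empty]
  exact Γ.exists_face_coloring hconn hplane _ (Γ.sum_offMatching path hM)

/-- The unicoloured half-edge at the vertex of a harmonic colouring belongs to a bridge. -/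
theorem isBridge_of_harmonic [Fintype D] [Fintype E] [Fintype V] (Γ : RibbonGraph V E D)
    (path : ∀ x : V, Fin 3 ≃ {d : D // Γ.vert d = x}) (hconn : IsConnectedGraph Γ.graph)
    (hplane : Γ.IsPlane) {κ : D → ZMod 2} {d : D}
    (hκ : Γ.Compat κ (Γ.vertexState {Γ.vert d})) (hm : ∀ x, ¬ Γ.MonoAt κ x)
    (hd : Γ.jump κ d = 0) : IsBridge Γ.graph (Γ.edge d) := by
  have hM := Γ.isPerfectMatching_monoEdges path hκ hm
  obtain ⟨κ₀, h₀, hj₀⟩ := Γ.exists_matching_coloring path hconn hplane hM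
  have hj : ∀ d, Γ.jump κ₀ d = Γ.jump κ d := fun d => by rw [hj₀, ← jump_eq_offMatching hκ]
  obtain ⟨φ, hφ⟩ := Γ.exists_eq_add_vert hj
  have hrel := (compat_add_iff h₀ hφ).1 hκ
  simp only [ind_empty, add_zero, hj] at hrel
  -- A loop would give two unicoloured half-edges at its vertex.
  have hne : Γ.vert (Γ.opp d) ≠ Γ.vert d := fun h =>
    Γ.opp_ne d ((Γ.existsUnique_jump_eq_zero path (hm (Γ.vert d))).unique
      ⟨h, by rwa [jump_opp hκ]⟩ ⟨rfl, hd⟩)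
  have hφd : φ (Γ.vert d) = φ (Γ.vert (Γ.opp d)) := by
    rw [← zmod_two_add_eq_zero, hrel, hd, zero_mul]
  rw [isBridge_iff]
  intro hwalk
  -- The function `φ` plus the indicator of the vertex of `d` is constant along every edge but that
  -- of `d`: on bicoloured edges by `hrel`, and on the other unicoloured edges because `φ` is
  -- constant and neither end is the vertex of `d`. Its values at the ends of `d` differ, so no walk
  -- avoids this edge.
  have h1 := reflTransGen_const (f := fun x => φ x + ind {Γ.vert d} x) ?_ hwalk
  · simp only [ind_singleton_self, ind_singleton_of_ne hne, hφd, add_zero] at h1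
    exact one_ne_zero (add_eq_left.1 h1)
  · intro x y hxy
    obtain ⟨d', hd', rfl, rfl⟩ := (Γ.deleteEdges_adj_iff _ _ _).1 hxy
    have h2 := hrel d'
    have key : ∀ a b a' b' : ZMod 2, a + b = a' + b' → a + a' = b + b' := by decide
    apply key
    rcases zmod_two_cases (Γ.jump κ d') with h3 | h3
    · have h4 : Γ.vert d' ≠ Γ.vert d := by
        intro h
        apply hd'
        rw [(Γ.existsUnique_jump_eq_zero path (hm (Γ.vert d))).unique ⟨h, h3⟩ ⟨rfl, hd⟩]
      have h5 : Γ.vert (Γ.opp d') ≠ Γ.vert d := by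
        intro h
        apply hd'
        rw [← Γ.edge_opp, (Γ.existsUnique_jump_eq_zero path (hm (Γ.vert d))).unique
          ⟨h, by rwa [jump_opp hκ]⟩ ⟨rfl, hd⟩]
      rw [h2, h3, zero_mul, ind_singleton_of_ne h4, ind_singleton_of_ne h5, add_zero]
    · rw [h2, h3, one_mul]

/-- The two colourings differ by a function of the vertex. As they belong to the same state, the
right side in `compat_add_iff` cancels and this function is constant, so one corner decides. -/
theorem harmonic_eq [Fintype D] (Γ : RibbonGraph V E D) (hconn : IsConnectedGraph Γ.graph)
    {κ κ' : D → ZMod 2} {S : Finset V} (hκ : Γ.Compat κ (Γ.vertexState S))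
    (hκ' : Γ.Compat κ' (Γ.vertexState S)) (hM : Γ.monoEdges κ = Γ.monoEdges κ') {d : D}
    (hd : κ d = κ' d) : κ = κ' := by
  have hj : ∀ d, Γ.jump κ' d = Γ.jump κ d := fun d => by
    rw [jump_eq_offMatching hκ, jump_eq_offMatching hκ', hM]
  obtain ⟨φ, hφ⟩ := Γ.exists_eq_add_vert hj
  have hrel := (compat_add_iff hκ' hφ).1 hκ
  have hconst := eq_of_connected hconn (φ := φ) fun d => by
    have key : ∀ a b c : ZMod 2, c * (a + b + a + b) = 0 := by decide
    rw [← zmod_two_add_eq_zero, hrel, key]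
  have h0 : φ (Γ.vert d) = 0 := by
    have := hφ d
    rw [hd] at this
    exact left_eq_add.1 this
  funext d'
  rw [hφ, hconst _ (Γ.vert d), h0, add_zero]

/-- A perfect matching, a half of a bridge and a colour determine a harmonic colouring. -/
theorem exists_harmonic [Fintype D] [Fintype E] [Fintype V] (Γ : RibbonGraph V E D)
    (path : ∀ x : V, Fin 3 ≃ {d : D // Γ.vert d = x}) (hconn : IsConnectedGraph Γ.graph)
    (hplane : Γ.IsPlane) {M : Set E} (hM : IsPerfectMatching Γ.graph M) {d : D}
    (hd : IsBridge Γ.graph (Γ.edge d)) (a : ZMod 2) :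
    ∃ κ, Γ.Compat κ (Γ.vertexState {Γ.vert d}) ∧ (∀ x, ¬ Γ.MonoAt κ x) ∧ Γ.monoEdges κ = M ∧
      Γ.jump κ d = 0 ∧ κ d = a := by
  obtain ⟨κ₀, h₀, hj₀⟩ := Γ.exists_matching_coloring path hconn hplane hM
  have hdM := Γ.mem_of_isBridge path hM hd
  have huniq := (Γ.isPerfectMatching_iff M).1 hM
  have hbr := (Γ.isBridge_iff d).1 hd
  let U : V → Prop := Relation.ReflTransGen (Γ.graph.deleteEdges {Γ.edge d}).Adj (Γ.vert d)
  let u : V → ZMod 2 := fun x => if U x then 1 else 0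
  have hud : u (Γ.vert d) = 1 := if_pos Relation.ReflTransGen.refl
  have huo : u (Γ.vert (Γ.opp d)) = 0 := if_neg hbr
  have hne : Γ.vert (Γ.opp d) ≠ Γ.vert d := by
    intro h
    rw [h, hud] at huo
    exact one_ne_zero huo
  -- Here `u` is the indicator of the side of the bridge that contains the vertex of `d`, so `φ`
  -- plus the indicator of that vertex changes only across the bridge. Both indicators are `1` at
  -- this vertex and cancel, so the constant `κ₀ d + a` makes `κ d = a`.
  let φ : V → ZMod 2 := fun x => u x + ind {Γ.vert d} x + (κ₀ d + a)
  let κ : D → ZMod 2 := fun d => κ₀ d + φ (Γ.vert d)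
  have hκ : ∀ d, κ d = κ₀ d + φ (Γ.vert d) := fun _ => rfl
  have hj : ∀ d, Γ.jump κ d = offMatching M (Γ.edge d) := fun d => by
    rw [Γ.jump_of_eq_add_vert hκ, hj₀]
  have hcompat : Γ.Compat κ (Γ.vertexState {Γ.vert d}) := by
    rw [compat_add_iff h₀ hκ]
    intro d'
    simp only [ind_empty, add_zero, hj₀, φ]
    have key : ∀ p q r s c : ZMod 2, p + q + c + (r + s + c) = (p + r) + (q + s) := by decide
    rw [key]
    by_cases he : Γ.edge d' = Γ.edge d
    · rw [he, offMatching_eq_zero_iff.2 hdM, zero_mul]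
      rcases (Γ.edge_eq_iff d d').1 he.symm with rfl | rfl
      · rw [hud, huo, ind_singleton_self, ind_singleton_of_ne hne]
        decide
      · rw [Γ.opp_opp, hud, huo, ind_singleton_self, ind_singleton_of_ne hne]
        decide
    · have hadj : (Γ.graph.deleteEdges {Γ.edge d}).Adj (Γ.vert d') (Γ.vert (Γ.opp d')) :=
        (Γ.deleteEdges_adj_iff _ _ _).2 ⟨_, he, rfl, rfl⟩
      have hU : U (Γ.vert d') ↔ U (Γ.vert (Γ.opp d')) :=
        ⟨fun h => h.tail hadj, fun h => h.tail hadj.symm⟩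
      have hu : u (Γ.vert d') = u (Γ.vert (Γ.opp d')) := by
        simp only [u, hU]
      rw [hu, zmod_two_add_self, zero_add]
      by_cases hdM' : Γ.edge d' ∈ M
      · have h4 : Γ.vert d' ≠ Γ.vert d := by
          intro h
          apply he
          rw [(huniq (Γ.vert d)).unique ⟨h, hdM'⟩ ⟨rfl, hdM⟩]
        have h5 : Γ.vert (Γ.opp d') ≠ Γ.vert d := by
          intro h
          apply he
          rw [← Γ.edge_opp, (huniq (Γ.vert d)).unique ⟨h, by rwa [Γ.edge_opp]⟩ ⟨rfl, hdM⟩]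
        rw [ind_singleton_of_ne h4, ind_singleton_of_ne h5, add_zero, mul_zero]
      · rw [offMatching, if_neg hdM', one_mul]
  refine ⟨κ, hcompat, ?_, ?_, ?_, ?_⟩
  · intro x hx
    -- At a unicoloured vertex all three half-edges would belong to `M`.
    have h1 : ∀ k, (path x k : D) = path x 0 := fun k =>
      (huniq x).unique
        ⟨(path x k).2, offMatching_eq_zero_iff.1 ((hj _).symm.trans (hx _ (path x k).2))⟩
        ⟨(path x 0).2, offMatching_eq_zero_iff.1 ((hj _).symm.trans (hx _ (path x 0).2))⟩
    exact absurd ((path x).injective (Subtype.ext (h1 1))) (by decide)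
  · ext e
    rw [← Γ.edge_halfOf e, mem_monoEdges_iff hcompat, hj, offMatching_eq_zero_iff]
  · rw [hj, offMatching_eq_zero_iff]
    exact hdM
  · have key : ∀ p q : ZMod 2, p + (1 + 1 + (p + q)) = q := by decide
    simp only [κ, φ]
    rw [hud, ind_singleton_self, key]

theorem card_halfBridge [Fintype D] [Fintype E] (Γ : RibbonGraph V E D) :
    Nat.card {d : D // IsBridge Γ.graph (Γ.edge d)} =
      2 * {e : E | IsBridge Γ.graph e}.ncard := by
  rw [Nat.card_eq_fintype_card, Fintype.card_subtype, Finset.card_filter, Γ.sum_halfOf,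
    Set.ncard_eq_toFinset_card', Set.toFinset_ofPred, Finset.card_filter, Finset.mul_sum]
  refine Finset.sum_congr rfl fun e _ => ?_
  rw [Γ.edge_opp, Γ.edge_halfOf, two_mul]

/-- The bijection sends `(κ, x)` to its unicoloured edges, the unicoloured half-edge at `x`, and the
colour there. That half-edge recovers `x`, and a bridge yields two half-edges. -/
theorem card_harmonicColoring [Fintype D] [Fintype E] [Fintype V] (Γ : RibbonGraph V E D)
    (path : ∀ x : V, Fin 3 ≃ {d : D // Γ.vert d = x}) (hconn : IsConnectedGraph Γ.graph)
    (hplane : Γ.IsPlane) :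
    Nat.card Γ.HarmonicColoring = 4 * {M : Set E | IsPerfectMatching Γ.graph M}.ncard *
      {e : E | IsBridge Γ.graph e}.ncard := by
  choose half hhalf _ using fun q : Γ.HarmonicColoring =>
    Γ.existsUnique_jump_eq_zero path (q.2.2 q.1.2)
  let Θ : Γ.HarmonicColoring → {M : Set E | IsPerfectMatching Γ.graph M} ×
      {d : D // IsBridge Γ.graph (Γ.edge d)} × ZMod 2 := fun q =>
    ⟨⟨Γ.monoEdges q.1.1, Γ.isPerfectMatching_monoEdges path q.2.1 q.2.2⟩,
      ⟨half q, Γ.isBridge_of_harmonic path hconn hplane (by rw [(hhalf q).1]; exact q.2.1) q.2.2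
        (hhalf q).2⟩, q.1.1 (half q)⟩
  have hΘ : Function.Bijective Θ := by
    constructor
    · intro q q' h
      simp only [Θ, Prod.mk.injEq, Subtype.mk.injEq] at h
      obtain ⟨h1, h2, h3⟩ := h
      have hv : q.1.2 = q'.1.2 := by rw [← (hhalf q).1, ← (hhalf q').1, h2]
      refine Subtype.ext (Prod.ext ?_ hv)
      refine Γ.harmonic_eq hconn q.2.1 (by rw [hv]; exact q'.2.1) h1 (d := half q) ?_
      rw [h3, h2]
    · rintro ⟨⟨M, hM⟩, ⟨d, hd⟩, a⟩
      obtain ⟨κ, h1, h2, h3, h4, h5⟩ := Γ.exists_harmonic path hconn hplane hM hd a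
      have hq : half ⟨(κ, Γ.vert d), h1, h2⟩ = d :=
        (Γ.existsUnique_jump_eq_zero path (h2 (Γ.vert d))).unique
          (hhalf ⟨(κ, Γ.vert d), h1, h2⟩) ⟨rfl, h4⟩
      refine ⟨⟨(κ, Γ.vert d), h1, h2⟩, ?_⟩
      simp only [Θ, Prod.mk.injEq, Subtype.mk.injEq, hq]
      exact ⟨h3, trivial, h5⟩
  rw [Nat.card_eq_of_bijective Θ hΘ, Nat.card_prod, Nat.card_prod, Γ.card_halfBridge,
    Nat.card_coe_set_eq, Nat.card_zmod]
  ring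

end VertexHomology.RibbonGraph

theorem mainTheorem7 {V : Type*} {E : Type*} {D : Type*} [LinearOrder V] [Fintype V] [Fintype E]
    [Fintype D] (Γ : VertexHomology.RibbonGraph V E D)
    (path : ∀ x : V, Fin 3 ≃ {d : D // Γ.vert d = x})
    (hconn : VertexHomology.IsConnectedGraph Γ.graph)
    (htri : VertexHomology.IsTrivalent Γ.graph)
    (hplane : Γ.IsPlane) (b m : ℕ)
    (hb : {e : E | VertexHomology.IsBridge Γ.graph e}.ncard = b)
    (hm : {M : Set E | VertexHomology.IsPerfectMatching Γ.graph M}.ncard = m) :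
    Γ.filteredDifferential 2 path ∘ₗ Γ.filteredDifferential 2 path = 0 ∧
    Module.finrank ℂ (Γ.FilteredVertexHomology 2 path 1) = 4 * m * b ∧
    ((∀ e : E, ¬ VertexHomology.IsBridge Γ.graph e) →
      Subsingleton (Γ.FilteredVertexHomology 2 path 1)) := by
  have hcard := Γ.card_harmonicColoring path hconn hplane
  rw [hb, hm] at hcard
  refine ⟨Γ.filteredDifferential_comp_self path, ?_, fun h => ?_⟩
  · rw [Γ.finrank_homology path, hcard]
  · have h0 : b = 0 := by
      rw [← hb, Set.ncard_eq_zero]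
      exact Set.eq_empty_iff_forall_notMem.2 h
    rw [h0, mul_zero, Nat.card_eq_zero] at hcard
    -- `Nat.card` is also zero on infinite types, which finiteness excludes here.
    have : IsEmpty Γ.HarmonicColoring := hcard.resolve_right fun h1 => h1.not_finite inferInstance
    exact Γ.subsingleton_homology path
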